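/- Let $n\ge 2$ and $\alpha\in(0,1)$. For $\varphi\in C^\infty_c(\mathbb R^n;\mathbb R^n)$ let $$\operatorname{div}^\alpha\varphi(x)=\mu_{n,\alpha}\lim_{\varepsilon\to0^+}\int_{\{|y|>\varepsilon\}}\frac{y\cdot\varphi(x+y)}{|y|^{n+\alpha+1}}\,dy,\qquad \mu_{n,\alpha}=2^\alpha\pi^{-n/2}\,\frac{\Gamma\left(\frac{n+\alpha+1}2\right)}{\Gamma\left(\frac{1-\alpha}2\right)},$$ and for $f\in L^1(\mathbb R^n)$ let $$|D^\alpha f|(\mathbb R^n)=\sup\Big\{\int_{\mathbb R^n} f\,\operatorname{div}^\alpha\varphi\,dx:\ \varphi\in C_c^\infty(\mathbb R^n;\mathbb R^n),\ \|\varphi\|_{L^\infty}\le1\Big\}.$$ Let $BV^\alpha(\mathbb R^n)$ be the space of $f\in L^1(\mathbb R^n)$ with $|D^\alpha f|(\mathbb R^n)<\infty$, with norm $\|f\|_{L^1}+|D^\alpha f|(\mathbb R^n)$, and let $B^\alpha_{1,\infty}(\mathbb R^n)$ be the Besov space of $f\in L^1(\mathbb R^n)$ with $[f]:=\sup_{h\ne0}|h|^{-\alpha}\|f(\cdot+h)-f\|_{L^1}<\infty$,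 with norm $\|f\|_{L^1}+[f]$. Then $BV^\alpha(\mathbb R^n)\subset B^\alpha_{1,\infty}(\mathbb R^n)$, the inclusion is continuous (there is a constant $C$, depending only on $n$ and $\alpha$, with $\|f\|_{B^\alpha_{1,\infty}}\le C\|f\|_{BV^\alpha}$ for all $f\in BV^\alpha(\mathbb R^n)$), and it is strict. Moreover, let $\eta\in C^\infty_c(\mathbb R)$ be any function with $0\le\eta\le1$, $\eta=1$ on $[-\frac12,\frac12]$, $\operatorname{supp}\eta\subset[-1,1]$ and $\operatorname{Lip}(\eta)\le3$, and put $\eta_1(x)=\eta(|x|)$ for $x\in\mathbb R^n$. Then the function $f(x)=\eta_1(x)\,|x|^{\alpha-n}$ belongs to $B^\alpha_{1,\infty}(\mathbb R^n)$, but not to $L^{n/(n-\alpha)}(\mathbb R^n)$, and not to $BV^\alpha(\mathbb R^n)$. -/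

import Mathlib

open MeasureTheory Filter Topology
open scoped NNReal ENNReal ContDiff

noncomputable section

namespace FracBV

/-- The constant `μ_{n,α} = 2^α π^{-n/2} Γ((n+α+1)/2) / Γ((1-α)/2)`. -/
def muConst (n : ℕ) (α : ℝ) : ℝ :=
  (2 : ℝ) ^ α * Real.pi ^ (-((n : ℝ) / 2)) *
    (Real.Gamma (((n : ℝ) + α + 1) / 2) / Real.Gamma ((1 - α) / 2))

/-- The fractional `α`-divergence of a vector field, as a principal value at the origin.
For smooth compactly supported `φ` and `α ∈ (0,1)` the integrals converge and the limit exists. -/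
def fracDiv {n : ℕ} (α : ℝ) (φ : EuclideanSpace ℝ (Fin n) → EuclideanSpace ℝ (Fin n))
    (x : EuclideanSpace ℝ (Fin n)) : ℝ :=
  muConst n α *
    limUnder (𝓝[>] (0 : ℝ)) (fun ε : ℝ =>
      ∫ y in {y : EuclideanSpace ℝ (Fin n) | ε < ‖y‖},
        inner ℝ y (φ (x + y)) / ‖y‖ ^ ((n : ℝ) + α + 1))

/-- Vector fields in `C_c^∞(ℝⁿ; ℝⁿ)` with sup norm at most `1`. -/
structure IsTestField {n : ℕ} (φ : EuclideanSpace ℝ (Fin n) → EuclideanSpace ℝ (Fin n)) :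
    Prop where
  smooth : ContDiff ℝ (∞ : WithTop ℕ∞) φ
  compactSupport : HasCompactSupport φ
  norm_le_one : ∀ x, ‖φ x‖ ≤ 1

/-- The fractional variation `|D^α f|(ℝⁿ)`, the supremum of `∫ f div^α φ` over test fields.
Since `φ = 0` is allowed, the supremum is nonnegative and truncating at `0` is harmless. -/
def fracVariation {n : ℕ} (α : ℝ) (f : EuclideanSpace ℝ (Fin n) → ℝ) : ℝ≥0∞ :=
  ⨆ (φ : EuclideanSpace ℝ (Fin n) → EuclideanSpace ℝ (Fin n)) (_ : IsTestField φ),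
    ENNReal.ofReal (∫ x, f x * fracDiv α φ x)

/-- `BV^α(ℝⁿ)`: the integrable functions of finite fractional `α`-variation. -/
def BVSpace (n : ℕ) (α : ℝ) : Set (EuclideanSpace ℝ (Fin n) → ℝ) :=
  {f | MemLp f 1 volume ∧ fracVariation α f < ⊤}

/-- The norm of `BV^α(ℝⁿ)`. -/
def bvNorm {n : ℕ} (α : ℝ) (f : EuclideanSpace ℝ (Fin n) → ℝ) : ℝ≥0∞ :=
  eLpNorm f 1 volume + fracVariation α f

/-- The Besov seminorm `sup_{h ≠ 0} ‖f(· + h) - f‖_{L¹} / |h|^α`. -/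
def besovSeminorm {n : ℕ} (α : ℝ) (f : EuclideanSpace ℝ (Fin n) → ℝ) : ℝ≥0∞ :=
  ⨆ (h : EuclideanSpace ℝ (Fin n)) (_ : h ≠ 0),
    eLpNorm (fun x => f (x + h) - f x) 1 volume / ENNReal.ofReal (‖h‖ ^ α)

/-- The Besov space `B^α_{1,∞}(ℝⁿ)`, for `α ∈ (0,1)`. -/
def BesovSpace (n : ℕ) (α : ℝ) : Set (EuclideanSpace ℝ (Fin n) → ℝ) :=
  {f | MemLp f 1 volume ∧ besovSeminorm α f < ⊤}

/-- The norm of `B^α_{1,∞}(ℝⁿ)`. -/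
def besovNorm {n : ℕ} (α : ℝ) (f : EuclideanSpace ℝ (Fin n) → ℝ) : ℝ≥0∞ :=
  eLpNorm f 1 volume + besovSeminorm α f

/-- Admissible profiles `η ∈ C_c^∞(ℝ)` of the cut-off functions. -/
structure IsCutoffProfile (η : ℝ → ℝ) : Prop where
  smooth : ContDiff ℝ (∞ : WithTop ℕ∞) η
  nonneg : ∀ t, 0 ≤ η t
  le_one : ∀ t, η t ≤ 1
  eq_one : ∀ t ∈ Set.Icc (-(1 / 2) : ℝ) (1 / 2), η t = 1
  tsupport_subset : tsupport η ⊆ Set.Icc (-1 : ℝ) 1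
  lipschitz : LipschitzWith 3 η

/-- The cut-off functions `η_R(x) = η(|x| / R)`. -/
def cutoff {n : ℕ} (η : ℝ → ℝ) (R : ℝ) (x : EuclideanSpace ℝ (Fin n)) : ℝ :=
  η (‖x‖ / R)

/-- The function `η_1(x) |x|^{α - n}`. -/
def witness (n : ℕ) (α : ℝ) (η : ℝ → ℝ) (x : EuclideanSpace ℝ (Fin n)) : ℝ :=
  cutoff η 1 x * ‖x‖ ^ (α - (n : ℝ))

end FracBV

end

noncomputable section

namespace FracBV

/-! Embedding. The kernel `rieszKer`, K(z) = z / |z|^{n+1-α}, is up to a negative constant the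
gradient of the Riesz kernel of order 1 + α, so div^α should invert convolution with it: div^α(K *
u) is a positive multiple of u (`exists_pvDiv_rieszConv`). For a test function g with |g| ≤ 1, put u
= g(· - h) - g. Then ∫ (f(· + h) - f) g = ∫ f u is a multiple of ∫ f div^α(K * u). The difference
can be moved onto the kernel, K * u = g * (K(· - h) - K), so this field is bounded by ‖K(· - h) -
K‖_{L¹}, which is O(|h|^α) by homogeneity. Hence the pairing is at most C |h|^α |D^α f|(ℝⁿ), and the
supremum over g gives the Besov bound. The field lacks compact support; `integral_mul_pvDiv_le`
removes that restriction by cut-offs.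

Inversion is proved without the Fourier transform. Both kernels are superpositions of Gaussian
fields y e^{-l|y|²} and z e^{-ν|z|²}; pairing two such fields is explicit and depends on w only
through κ|w|², with κ = lν/(l+ν). The substitution ν = l v separates the double integral into a
constant and an integral over κ. The latter has an exact antiderivative built from the Gaussian
means of u, whose limit as κ → ∞ recovers u(x) (`integral_rpow_mul_gaussDefect`).

The witness. Near 0 it equals |x|^{α-n}. It has the same size and increment bounds as K, so one
estimate, `integral_translate_sub_le`, puts it in the Besov space. Its power n/(n-α) is |x|^{-n}
near 0, which is not integrable. For infinite variation, test against ψ(x) x/|x| with ψ supported in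
a shell. Fubini moves the singular integral onto f; after symmetrising in y the integrand is
nonnegative near the origin, and on the ball of radius |x|/2 about x it is at least c|x|^{-2n}. The
pairing thus dominates c ∫ ψ |x|^{-n} - C ∫ ψ, which is unbounded as the inner radius of the shell
shrinks. -/

/-- The Euclidean space `ℝⁿ`. -/
abbrev Euc (n : ℕ) := EuclideanSpace ℝ (Fin n)

/-- The surface measure of the unit sphere of `ℝⁿ`. -/
def sphereArea (n : ℕ) : ℝ := n * volume.real (Metric.ball (0 : Euc n) 1)

theorem sphereArea_nonneg (n : ℕ) : 0 ≤ sphereArea n := by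
  unfold sphereArea; positivity

/-! ### Radial integrals -/

/-- The factor `y ^ (n - 1)` is the Jacobian of polar coordinates. -/
theorem pow_pred_mul_rpow {n : ℕ} (hn : 1 ≤ n) {y : ℝ} (hy : 0 < y) (s : ℝ) :
    y ^ (n - 1) * y ^ s = y ^ ((n : ℝ) + s - 1) := by
  rw [← Real.rpow_natCast, ← Real.rpow_add hy, Nat.cast_sub hn]
  congr 1; push_cast; ring

/-- Both directions matter: s = α - n gives the integrability of K and of the witness near 0, while
the failure at s = -n is the contradiction behind both negative statements. -/
theorem integrableOn_ball_norm_rpow_iff {n : ℕ} (hn : 1 ≤ n) {s r : ℝ} (hr : 0 < r) :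
    IntegrableOn (fun x : Euc n => ‖x‖ ^ s) (Metric.ball 0 r) ↔ 0 < (n : ℝ) + s := by
  have : Nontrivial (Euc n) := Module.nontrivial_of_finrank_pos (R := ℝ) (by simp; omega)
  rw [integrableOn_fun_norm_addHaar volume (f := fun y => y ^ s)]
  rw [integrableOn_congr_fun (g := fun y => y ^ ((n : ℝ) + s - 1)) _ measurableSet_Ioo,
    intervalIntegral.integrableOn_Ioo_rpow_iff hr]
  · constructor <;> intro h <;> linarith
  · intro y hy
    simp only [finrank_euclideanSpace_fin, smul_eq_mul]
    exact pow_pred_mul_rpow hn hy.1 s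

theorem integral_ball_norm_rpow {n : ℕ} (hn : 1 ≤ n) {β r : ℝ} (hβ : 0 < β) (hr : 0 ≤ r) :
    ∫ x : Euc n in Metric.ball 0 r, ‖x‖ ^ (β - n) = sphereArea n * (r ^ β / β) := by
  have : Nontrivial (Euc n) := Module.nontrivial_of_finrank_pos (R := ℝ) (by simp; omega)
  have h := integral_fun_norm_addHaar (volume : Measure (Euc n))
    (fun y => (Set.Iio r).indicator (fun y : ℝ => y ^ (β - n)) y)
  rw [← integral_indicator measurableSet_ball]
  have e : (fun x : Euc n => (Metric.ball (0 : Euc n) r).indicator (fun x => ‖x‖ ^ (β - n)) x) =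
      fun x => (Set.Iio r).indicator (fun y : ℝ => y ^ (β - n)) ‖x‖ := by
    ext x; simp [Set.indicator]
  rw [e, h]
  have e2 : ∫ y in Set.Ioi (0 : ℝ), y ^ (Module.finrank ℝ (Euc n) - 1) •
      (Set.Iio r).indicator (fun y : ℝ => y ^ (β - n)) y = r ^ β / β := by
    have : ∫ y in Set.Ioi (0 : ℝ), y ^ (Module.finrank ℝ (Euc n) - 1) •
        (Set.Iio r).indicator (fun y : ℝ => y ^ (β - n)) y =
        ∫ y in Set.Ioi (0 : ℝ), (Set.Iio r).indicator (fun y : ℝ => y ^ (β - 1)) y := by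
      refine setIntegral_congr_fun measurableSet_Ioi fun y hy => ?_
      by_cases hyr : y < r
      · have hp := pow_pred_mul_rpow hn hy (β - n)
        simp only [finrank_euclideanSpace_fin, Set.indicator, Set.mem_Iio, hyr, if_true,
          smul_eq_mul]
        rw [hp]; congr 1; ring
      · simp [Set.indicator, hyr]
    rw [this, setIntegral_indicator measurableSet_Iio, Set.Ioi_inter_Iio,
      ← integral_Ioc_eq_integral_Ioo, ← intervalIntegral.integral_of_le hr,
      integral_rpow (Or.inl (by linarith))]
    simp [Real.zero_rpow hβ.ne']
  rw [e2]
  simp [sphereArea, mul_assoc]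

theorem integrableOn_compl_ball_norm_rpow {n : ℕ} (hn : 1 ≤ n) {β r : ℝ} (hβ : 0 < β)
    (hr : 0 < r) :
    IntegrableOn (fun x : Euc n => ‖x‖ ^ (-β - n)) (Metric.ball 0 r)ᶜ := by
  have : Nontrivial (Euc n) := Module.nontrivial_of_finrank_pos (R := ℝ) (by simp; omega)
  rw [← integrable_indicator_iff measurableSet_ball.compl]
  have e : (Metric.ball (0 : Euc n) r)ᶜ.indicator (fun x => ‖x‖ ^ (-β - n)) =
      fun x => (Set.Ici r).indicator (fun y : ℝ => y ^ (-β - n)) ‖x‖ := by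
    ext x; simp [Set.indicator]
  rw [e, integrable_fun_norm_addHaar volume
    (f := (Set.Ici r).indicator (fun y : ℝ => y ^ (-β - n)))]
  have h : IntegrableOn ((Set.Ici r).indicator (fun y : ℝ => y ^ (-β - 1))) (Set.Ioi 0) := by
    refine ((integrable_indicator_iff measurableSet_Ici).2 ?_).integrableOn
    rw [integrableOn_Ici_iff_integrableOn_Ioi]
    exact integrableOn_Ioi_rpow_of_lt (by linarith) hr
  refine h.congr_fun (fun y hy => ?_) measurableSet_Ioi
  by_cases hyr : r ≤ y
  · have hp := pow_pred_mul_rpow hn hy (-β - n)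
    simp only [finrank_euclideanSpace_fin, Set.indicator, Set.mem_Ici, hyr, if_true,
      smul_eq_mul]
    rw [hp]; congr 1; ring
  · simp [Set.indicator, hyr]

theorem integral_compl_ball_norm_rpow {n : ℕ} (hn : 1 ≤ n) {β r : ℝ} (hβ : 0 < β) (hr : 0 < r) :
    ∫ x : Euc n in (Metric.ball 0 r)ᶜ, ‖x‖ ^ (-β - n) = sphereArea n * (r ^ (-β) / β) := by
  have : Nontrivial (Euc n) := Module.nontrivial_of_finrank_pos (R := ℝ) (by simp; omega)
  have h := integral_fun_norm_addHaar (volume : Measure (Euc n))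
    (fun y => (Set.Ici r).indicator (fun y : ℝ => y ^ (-β - n)) y)
  rw [← integral_indicator measurableSet_ball.compl]
  have e : (fun x : Euc n => (Metric.ball (0 : Euc n) r)ᶜ.indicator (fun x => ‖x‖ ^ (-β - n)) x) =
      fun x => (Set.Ici r).indicator (fun y : ℝ => y ^ (-β - n)) ‖x‖ := by
    ext x; simp [Set.indicator]
  rw [e, h]
  have e2 : ∫ y in Set.Ioi (0 : ℝ), y ^ (Module.finrank ℝ (Euc n) - 1) •
      (Set.Ici r).indicator (fun y : ℝ => y ^ (-β - n)) y = r ^ (-β) / β := by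
    have : ∫ y in Set.Ioi (0 : ℝ), y ^ (Module.finrank ℝ (Euc n) - 1) •
        (Set.Ici r).indicator (fun y : ℝ => y ^ (-β - n)) y =
        ∫ y in Set.Ioi (0 : ℝ), (Set.Ici r).indicator (fun y : ℝ => y ^ (-β - 1)) y := by
      refine setIntegral_congr_fun measurableSet_Ioi fun y hy => ?_
      by_cases hyr : r ≤ y
      · have hp := pow_pred_mul_rpow hn hy (-β - n)
        simp only [finrank_euclideanSpace_fin, Set.indicator, Set.mem_Ici, hyr, if_true,
          smul_eq_mul]
        rw [hp]; congr 1; ring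
      · simp [Set.indicator, hyr]
    rw [this, setIntegral_indicator measurableSet_Ici,
      Set.inter_eq_right.2 (Set.Ici_subset_Ioi.2 hr), integral_Ici_eq_integral_Ioi,
      integral_Ioi_rpow_of_lt (by linarith) hr]
    simp [neg_div_neg_eq]
  rw [e2]
  simp [sphereArea, mul_assoc]

/-! ### Translation estimates for kernels with a power singularity -/

/-- Mean value inequality on [m, ∞), where the derivative is largest in absolute value at m. -/
theorem abs_rpow_neg_sub_rpow_neg_le {m q r s : ℝ} (hm : 0 < m) (hq : 0 ≤ q) (hr : m ≤ r)
    (hs : m ≤ s) : |r ^ (-q) - s ^ (-q)| ≤ q * m ^ (-q - 1) * |r - s| := by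
  have h := (convex_Ici m).norm_image_sub_le_of_norm_deriv_le (f := fun t : ℝ => t ^ (-q))
    (C := q * m ^ (-q - 1)) (x := s) (y := r) ?_ ?_ hs hr
  · simpa using h
  · intro t ht
    exact (Real.hasDerivAt_rpow_const (Or.inl (hm.trans_le ht).ne')).differentiableAt
  · intro t ht
    have ht0 : 0 < t := hm.trans_le ht
    rw [(Real.hasDerivAt_rpow_const (Or.inl ht0.ne')).deriv, norm_mul, Real.norm_eq_abs, abs_neg,
      abs_of_nonneg hq, Real.norm_of_nonneg (by positivity)]
    have := Real.rpow_le_rpow_of_nonpos (z := -q - 1) hm ht (by linarith)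
    gcongr

/-- Split at |x| = 2|h|. Inside, the two values are bounded separately by size, the translated one
living in the ball of radius 3|h|; outside, the increment bound applies. Each of the three radial
integrals scales as |h|^α. The lemma serves both the kernel K and the witness. -/
theorem integral_translate_sub_le {n : ℕ} (hn : 1 ≤ n) {α : ℝ} (hα0 : 0 < α) (hα1 : α < 1)
    {G : Type*} [NormedAddCommGroup G] {F : Euc n → G} (hF : AEStronglyMeasurable F)
    {A B : ℝ} (hA : ∀ x, ‖F x‖ ≤ A * ‖x‖ ^ (α - n)) (h : Euc n)
    (hB : ∀ x, 2 * ‖h‖ ≤ ‖x‖ → ‖F (x + h) - F x‖ ≤ B * ‖h‖ * ‖x‖ ^ (α - 1 - n)) :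
    Integrable (fun x => F (x + h) - F x) ∧
    ∫ x, ‖F (x + h) - F x‖ ≤
      sphereArea n * (A * (2 ^ α / α) + A * (3 ^ α / α) + B * (2 ^ (α - 1) / (1 - α)))
        * ‖h‖ ^ α := by
  rcases eq_or_ne h 0 with rfl | hh
  · simp [Real.zero_rpow hα0.ne']
  have hh0 : 0 < ‖h‖ := norm_pos_iff.2 hh
  let p : Euc n → ℝ := fun x => (Metric.ball 0 (2 * ‖h‖)).indicator (fun x => ‖x‖ ^ (α - n)) x
  let q : Euc n → ℝ := fun x => (Metric.ball 0 (3 * ‖h‖)).indicator (fun x => ‖x‖ ^ (α - n)) x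
  let w : Euc n → ℝ :=
    fun x => (Metric.ball 0 (2 * ‖h‖))ᶜ.indicator (fun x => ‖x‖ ^ (-(1 - α) - n)) x
  have hp : Integrable p := (integrable_indicator_iff measurableSet_ball).2
    ((integrableOn_ball_norm_rpow_iff hn (by positivity)).2 (by simpa using hα0))
  have hq : Integrable q := (integrable_indicator_iff measurableSet_ball).2
    ((integrableOn_ball_norm_rpow_iff hn (by positivity)).2 (by simpa using hα0))
  have hw : Integrable w := (integrable_indicator_iff measurableSet_ball.compl).2
    (integrableOn_compl_ball_norm_rpow hn (by linarith) (by positivity))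
  have ip : ∫ x, p x = sphereArea n * ((2 * ‖h‖) ^ α / α) := by
    rw [integral_indicator measurableSet_ball, integral_ball_norm_rpow hn hα0 (by positivity)]
  have iq : ∫ x, q (x + h) = sphereArea n * ((3 * ‖h‖) ^ α / α) := by
    rw [integral_add_right_eq_self, integral_indicator measurableSet_ball,
      integral_ball_norm_rpow hn hα0 (by positivity)]
  have iw : ∫ x, w x = sphereArea n * ((2 * ‖h‖) ^ (α - 1) / (1 - α)) := by
    rw [integral_indicator measurableSet_ball.compl,
      integral_compl_ball_norm_rpow hn (by linarith) (by positivity), neg_sub]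
  have hbound : ∀ x, ‖F (x + h) - F x‖ ≤ A * p x + A * q (x + h) + B * ‖h‖ * w x := by
    intro x
    by_cases hx : ‖x‖ < 2 * ‖h‖
    · have hx' : ‖x + h‖ < 3 * ‖h‖ := by linarith [norm_add_le x h]
      have h1 : p x = ‖x‖ ^ (α - n) := by simp [p, Set.indicator, hx]
      have h2 : q (x + h) = ‖x + h‖ ^ (α - n) := by simp [q, Set.indicator, hx']
      have h3 : w x = 0 := by simp [w, Set.indicator, hx]
      rw [h1, h2, h3]
      linarith [norm_sub_le (F (x + h)) (F x), hA x, hA (x + h)]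
    · have h1 : p x = 0 := by simp [p, Set.indicator, hx]
      have h2 : 0 ≤ A * q (x + h) := by
        by_cases hx' : ‖x + h‖ < 3 * ‖h‖
        · have h2 : q (x + h) = ‖x + h‖ ^ (α - n) := by simp [q, Set.indicator, hx']
          rw [h2]; exact (norm_nonneg _).trans (hA _)
        · simp [q, Set.indicator, hx']
      have h3 : w x = ‖x‖ ^ (α - 1 - n) := by simp [w, Set.indicator, hx]
      rw [h1, h3]
      linarith [hB x (not_lt.1 hx)]
  have hdom : Integrable (fun x => A * p x + A * q (x + h) + B * ‖h‖ * w x) :=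
    ((hp.const_mul A).add ((hq.comp_add_right h).const_mul A)).add (hw.const_mul _)
  have hmeas : AEStronglyMeasurable (fun x => F (x + h) - F x) :=
    (hF.comp_measurePreserving (measurePreserving_add_right volume h)).sub hF
  refine ⟨hdom.mono' hmeas (Eventually.of_forall hbound), ?_⟩
  calc ∫ x, ‖F (x + h) - F x‖ ≤ ∫ x, (A * p x + A * q (x + h) + B * ‖h‖ * w x) :=
        integral_mono_of_nonneg (Eventually.of_forall fun _ => norm_nonneg _) hdom
          (Eventually.of_forall hbound)
    _ = _ := by
      have hpq : Integrable (fun x => A * p x + A * q (x + h)) :=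
        (hp.const_mul A).add ((hq.comp_add_right h).const_mul A)
      rw [integral_add hpq (hw.const_mul _), integral_add (hp.const_mul A) ((hq.comp_add_right h).const_mul A), integral_const_mul,
        integral_const_mul, integral_const_mul, ip, iq, iw, Real.mul_rpow (by norm_num) hh0.le,
        Real.mul_rpow (by norm_num) hh0.le, Real.mul_rpow (by norm_num) hh0.le]
      have : ‖h‖ ^ α = ‖h‖ ^ (α - 1) * ‖h‖ := by
        rw [← Real.rpow_add_one hh0.ne']; congr 1; ring
      rw [this]; ring

/-- The Riesz-type kernel `K(z) = z / |z|^{n+1-α}`. -/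
def rieszKer {n : ℕ} (α : ℝ) (z : Euc n) : Euc n := ‖z‖ ^ (-((n : ℝ) + 1 - α)) • z

theorem norm_rieszKer {n : ℕ} {α : ℝ} (hn : 1 ≤ n) (hα1 : α < 1) (z : Euc n) :
    ‖rieszKer α z‖ = ‖z‖ ^ (α - n) := by
  have hn' : (1 : ℝ) ≤ n := by exact_mod_cast hn
  rcases eq_or_ne z 0 with rfl | hz
  -- At the origin both sides are zero: `Real.rpow` sends 0 to 0 for the nonzero exponent α - n.
  · rw [norm_zero, Real.zero_rpow (by linarith)]; simp [rieszKer]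
  · rw [rieszKer, norm_smul, Real.norm_of_nonneg (by positivity),
      ← Real.rpow_add_one (norm_pos_iff.2 hz).ne']
    congr 1; ring

theorem measurable_rieszKer {n : ℕ} {α : ℝ} : Measurable (rieszKer α : Euc n → Euc n) := by
  unfold rieszKer; fun_prop

/-- Both |x| and |x + h| are at least |x|/2, so the mean value bound applies with m = |x|/2; this is
the source of the factor 2^{q+1}. -/
theorem abs_norm_rpow_sub_le {n : ℕ} {q : ℝ} (hq : 0 ≤ q) {x h : Euc n} (hh : h ≠ 0)
    (hx : 2 * ‖h‖ ≤ ‖x‖) :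
    |‖x + h‖ ^ (-q) - ‖x‖ ^ (-q)| ≤ q * 2 ^ (q + 1) * ‖h‖ * ‖x‖ ^ (-q - 1) := by
  have hh0 : 0 < ‖h‖ := norm_pos_iff.2 hh
  have hx0 : 0 < ‖x‖ := by linarith
  have h1 : ‖x‖ / 2 ≤ ‖x + h‖ := by
    have := norm_sub_norm_le x (-h); rw [sub_neg_eq_add, norm_neg] at this; linarith
  have h2 := abs_rpow_neg_sub_rpow_neg_le (half_pos hx0) hq h1 (half_le_self hx0.le)
  have h3 : |‖x + h‖ - ‖x‖| ≤ ‖h‖ := by simpa using abs_norm_sub_norm_le (x + h) x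
  calc _ ≤ q * (‖x‖ / 2) ^ (-q - 1) * ‖h‖ := h2.trans (by gcongr)
    _ = _ := by
      rw [Real.div_rpow hx0.le (by norm_num), show -q - 1 = -(q + 1) by ring,
        Real.rpow_neg (by norm_num : (0:ℝ) ≤ 2)]
      field_simp

/-- K is homogeneous of degree α - n and its increments away from 0 gain |h|/|x|. This is where the
Besov exponent α comes from. -/
theorem exists_integral_rieszKer_translate_le {n : ℕ} (hn : 1 ≤ n) {α : ℝ} (hα0 : 0 < α)
    (hα1 : α < 1) : ∃ C : ℝ, 0 < C ∧ ∀ h : Euc n,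
      Integrable (fun x => rieszKer α (x + h) - rieszKer α x) ∧
      ∫ x, ‖rieszKer α (x + h) - rieszKer α x‖ ≤ C * ‖h‖ ^ α := by
  have hn' : (1 : ℝ) ≤ n := by exact_mod_cast hn
  set q : ℝ := (n : ℝ) + 1 - α with hq
  set B : ℝ := 2 ^ q + q * 2 ^ (q + 1)
  set C := sphereArea n * (1 * (2 ^ α / α) + 1 * (3 ^ α / α) + B * (2 ^ (α - 1) / (1 - α)))
  have hq0 : 0 < q := by linarith
  refine ⟨|C| + 1, by positivity, fun h => ?_⟩
  have := integral_translate_sub_le hn hα0 hα1 (F := rieszKer α)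
    measurable_rieszKer.aestronglyMeasurable (A := 1) (B := B)
    (fun x => by rw [norm_rieszKer hn hα1, one_mul]) h ?_
  · refine ⟨this.1, this.2.trans ?_⟩
    gcongr
    linarith [le_abs_self C]
  · intro x hx
    rcases eq_or_ne h 0 with rfl | hh
    · simp
    have hh0 : 0 < ‖h‖ := norm_pos_iff.2 hh
    have hx0 : 0 < ‖x‖ := by linarith
    have h1 : ‖x‖ / 2 ≤ ‖x + h‖ := by
      have := norm_sub_norm_le x (-h); rw [sub_neg_eq_add, norm_neg] at this; linarith
    -- Product rule: one term moves the vector, the other moves the weight.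
    have e : rieszKer α (x + h) - rieszKer α x =
        ‖x + h‖ ^ (-q) • h + (‖x + h‖ ^ (-q) - ‖x‖ ^ (-q)) • x := by
      simp only [rieszKer, ← hq]; module
    have h2 : ‖x + h‖ ^ (-q) ≤ 2 ^ q * ‖x‖ ^ (-q) := by
      calc _ ≤ (‖x‖ / 2) ^ (-q) := Real.rpow_le_rpow_of_nonpos (half_pos hx0) h1 (by linarith)
        _ = _ := by
          rw [Real.div_rpow hx0.le (by norm_num), Real.rpow_neg (by norm_num : (0:ℝ) ≤ 2)]
          field_simp
    have h3 := abs_norm_rpow_sub_le hq0.le hh hx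
    have h4 : ‖x‖ ^ (-q) = ‖x‖ ^ (-q - 1) * ‖x‖ := by
      rw [← Real.rpow_add_one hx0.ne']; congr 1; ring
    rw [e, show α - 1 - n = -q by rw [hq]; ring]
    calc _ ≤ ‖x + h‖ ^ (-q) * ‖h‖ + |‖x + h‖ ^ (-q) - ‖x‖ ^ (-q)| * ‖x‖ := by
          refine (norm_add_le _ _).trans ?_
          rw [norm_smul, norm_smul, Real.norm_of_nonneg (by positivity), Real.norm_eq_abs]
      _ ≤ 2 ^ q * ‖x‖ ^ (-q) * ‖h‖ + q * 2 ^ (q + 1) * ‖h‖ * ‖x‖ ^ (-q - 1) * ‖x‖ := by gcongr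
      _ = B * ‖h‖ * ‖x‖ ^ (-q) := by simp only [B]; rw [h4]; ring

/-! ### The Besov seminorm and the witness -/

theorem eLpNorm_one_eq_ofReal {n : ℕ} {f : Euc n → ℝ} (hf : Integrable f) :
    eLpNorm f 1 volume = ENNReal.ofReal (∫ x, ‖f x‖) := by
  rw [eLpNorm_one_eq_lintegral_enorm, ofReal_integral_norm_eq_lintegral_enorm hf]

theorem besovSeminorm_le {n : ℕ} {α : ℝ} {f : Euc n → ℝ} {C : ℝ≥0∞}
    (h : ∀ h : Euc n, eLpNorm (fun x => f (x + h) - f x) 1 volume ≤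
      C * ENNReal.ofReal (‖h‖ ^ α)) : besovSeminorm α f ≤ C := by
  refine iSup₂_le fun v _ => ?_
  exact ENNReal.div_le_of_le_mul (h v)

/-- The properties of a cut-off profile on the half-line that the witness depends on. -/
structure IsRadialCutoff (η : ℝ → ℝ) (L : ℝ≥0) : Prop where
  nonneg : ∀ t, 0 ≤ η t
  le_one : ∀ t, η t ≤ 1
  eq_one : ∀ t, 0 ≤ t → t ≤ 1 / 2 → η t = 1
  eq_zero : ∀ t, 1 < t → η t = 0
  lipschitz : LipschitzWith L η

theorem IsCutoffProfile.isRadialCutoff {η : ℝ → ℝ} (h : IsCutoffProfile η) :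
    IsRadialCutoff η 3 where
  nonneg := h.nonneg
  le_one := h.le_one
  eq_one t h0 h1 := h.eq_one t ⟨by linarith, h1⟩
  eq_zero t ht := by
    by_contra hne
    exact absurd (h.tsupport_subset (subset_tsupport η hne)).2 (not_le.2 ht)
  lipschitz := h.lipschitz

/-- Strictness of the inclusion needs one concrete witness; a piecewise linear profile avoids
constructing a smooth one with Lipschitz constant at most 3. -/
theorem isRadialCutoff_piecewiseLinear :
    IsRadialCutoff (fun t => max 0 (min 1 (2 - 2 * t))) 2 where
  nonneg t := le_max_left _ _
  le_one t := max_le zero_le_one (min_le_left _ _)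
  eq_one t _ h1 := by
    rw [min_eq_left (by linarith), max_eq_right zero_le_one]
  eq_zero t ht := by
    rw [min_eq_right (by linarith), max_eq_left (by linarith)]
  lipschitz := by
    have h : LipschitzWith 2 (fun t : ℝ => 2 - 2 * t) :=
      LipschitzWith.of_dist_le_mul fun s t => by
        rw [Real.dist_eq, Real.dist_eq, show 2 - 2 * s - (2 - 2 * t) = (-2) * (s - t) by ring,
          abs_mul]
        norm_num
    exact (h.const_min 1).const_max 0

section Witness

variable {n : ℕ} {α : ℝ} {η : ℝ → ℝ} {L : ℝ≥0}

theorem witness_apply (x : Euc n) : witness n α η x = η ‖x‖ * ‖x‖ ^ (α - n) := by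
  simp [witness, cutoff]

theorem measurable_witness (hη : IsRadialCutoff η L) : Measurable (witness n α η) := by
  have : Measurable η := hη.lipschitz.continuous.measurable
  have e : witness n α η = fun x : Euc n => η ‖x‖ * ‖x‖ ^ (α - n) := funext witness_apply
  rw [e]
  exact (this.comp measurable_norm).mul (by fun_prop)

theorem witness_nonneg (hη : IsRadialCutoff η L) (x : Euc n) : 0 ≤ witness n α η x := by
  rw [witness_apply]
  exact mul_nonneg (hη.nonneg _) (by positivity)

theorem norm_witness_le (hη : IsRadialCutoff η L) (x : Euc n) :
    ‖witness n α η x‖ ≤ 1 * ‖x‖ ^ (α - n) := by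
  rw [Real.norm_of_nonneg (witness_nonneg hη x), witness_apply]
  gcongr
  exact hη.le_one _

theorem witness_eq_rpow (hη : IsRadialCutoff η L) {x : Euc n} (hx : ‖x‖ ≤ 1 / 2) :
    witness n α η x = ‖x‖ ^ (α - n) := by
  rw [witness_apply, hη.eq_one _ (norm_nonneg _) hx, one_mul]

theorem integrable_witness (hn : 1 ≤ n) (hα : 0 < α) (hη : IsRadialCutoff η L) :
    Integrable (witness n α η) := by
  have h : Integrable ((Metric.ball 0 2).indicator fun x : Euc n => ‖x‖ ^ (α - n)) :=
    (integrable_indicator_iff measurableSet_ball).2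
      ((integrableOn_ball_norm_rpow_iff hn two_pos).2 (by simpa using hα))
  refine h.mono' (measurable_witness hη).aestronglyMeasurable (Eventually.of_forall fun x => ?_)
  by_cases hx : ‖x‖ < 2
  · simpa [Set.indicator, hx] using norm_witness_le (α := α) hη x
  · simp [Set.indicator, hx, witness_apply, hη.eq_zero ‖x‖ (by linarith)]

theorem witness_translate_sub_le (hn : 1 ≤ n) (hα1 : α < 1) (hη : IsRadialCutoff η L)
    (h x : Euc n) (hx : 2 * ‖h‖ ≤ ‖x‖) :
    ‖witness n α η (x + h) - witness n α η x‖ ≤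
      ((n - α) * 2 ^ (n - α + 1) + 2 * L) * ‖h‖ * ‖x‖ ^ (α - 1 - n) := by
  have hn' : (1 : ℝ) ≤ n := by exact_mod_cast hn
  rcases eq_or_ne h 0 with rfl | hh
  · simp
  have hh0 : 0 < ‖h‖ := norm_pos_iff.2 hh
  have hx0 : 0 < ‖x‖ := by linarith
  have hp : 0 ≤ (n : ℝ) - α := by linarith
  have hd := abs_norm_rpow_sub_le hp hh hx
  have e : witness n α η (x + h) - witness n α η x =
      η ‖x + h‖ * (‖x + h‖ ^ (-((n : ℝ) - α)) - ‖x‖ ^ (-((n : ℝ) - α))) +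
        (η ‖x + h‖ - η ‖x‖) * ‖x‖ ^ (-((n : ℝ) - α)) := by
    rw [witness_apply, witness_apply, neg_sub]; ring
  have h2 : |(η ‖x + h‖ - η ‖x‖) * ‖x‖ ^ (-((n : ℝ) - α))| ≤
      2 * L * ‖h‖ * ‖x‖ ^ (-((n : ℝ) - α) - 1) := by
    -- For |x| ≤ 2 a factor |x| is traded for the constant 2, reaching the exponent one lower. For
    -- |x| > 2 also |x + h| > 1, so both cut-off values vanish.
    by_cases hx2 : ‖x‖ ≤ 2
    · have h3 : |η ‖x + h‖ - η ‖x‖| ≤ L * ‖h‖ := by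
        have h4 := hη.lipschitz.dist_le_mul ‖x + h‖ ‖x‖
        rw [Real.dist_eq, Real.dist_eq] at h4
        refine h4.trans ?_
        gcongr
        simpa using abs_norm_sub_norm_le (x + h) x
      have h5 : ‖x‖ ^ (-((n : ℝ) - α)) = ‖x‖ ^ (-((n : ℝ) - α) - 1) * ‖x‖ := by
        rw [← Real.rpow_add_one hx0.ne']; congr 1; ring
      rw [abs_mul, abs_of_nonneg (by positivity : 0 ≤ ‖x‖ ^ (-((n : ℝ) - α))), h5]
      calc _ ≤ L * ‖h‖ * (‖x‖ ^ (-((n : ℝ) - α) - 1) * 2) := by gcongr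
        _ = _ := by ring
    · have h1 : ‖x‖ / 2 ≤ ‖x + h‖ := by
        have := norm_sub_norm_le x (-h); rw [sub_neg_eq_add, norm_neg] at this; linarith
      rw [hη.eq_zero ‖x‖ (by linarith), hη.eq_zero ‖x + h‖ (by linarith)]
      simp only [sub_self, zero_mul, abs_zero]
      positivity
  rw [e, show α - 1 - n = -((n : ℝ) - α) - 1 by ring, Real.norm_eq_abs]
  calc _ ≤ |η ‖x + h‖ * (‖x + h‖ ^ (-((n : ℝ) - α)) - ‖x‖ ^ (-((n : ℝ) - α)))| + _ :=
        (abs_add_le _ _).trans (add_le_add_right h2 _)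
    _ ≤ 1 * ((n - α) * 2 ^ (n - α + 1) * ‖h‖ * ‖x‖ ^ (-((n : ℝ) - α) - 1)) + _ := by
        rw [abs_mul, abs_of_nonneg (hη.nonneg _)]
        gcongr
        exact hη.le_one _
    _ = _ := by ring

theorem witness_mem_besovSpace (hn : 1 ≤ n) (hα0 : 0 < α) (hα1 : α < 1)
    (hη : IsRadialCutoff η L) : witness n α η ∈ BesovSpace n α := by
  refine ⟨memLp_one_iff_integrable.2 (integrable_witness hn hα0 hη), ?_⟩
  set B : ℝ := (n - α) * 2 ^ (n - α + 1) + 2 * L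
  refine (besovSeminorm_le (C := ENNReal.ofReal (sphereArea n * (1 * (2 ^ α / α) +
    1 * (3 ^ α / α) + B * (2 ^ (α - 1) / (1 - α))))) fun h => ?_).trans_lt ENNReal.ofReal_lt_top
  have := integral_translate_sub_le hn hα0 hα1 (measurable_witness hη).aestronglyMeasurable
    (norm_witness_le hη) h (witness_translate_sub_le hn hα1 hη h)
  rw [eLpNorm_one_eq_ofReal this.1, ← ENNReal.ofReal_mul' (by positivity)]
  exact ENNReal.ofReal_le_ofReal this.2

/-- On the ball of radius 1/2 the power n/(n-α) of the witness is exactly |x|^{-n}. -/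
theorem witness_not_memLp (hn : 1 ≤ n) (hα0 : 0 < α) (hα1 : α < 1) (hη : IsRadialCutoff η L) :
    ¬ MemLp (witness n α η) (ENNReal.ofReal ((n : ℝ) / ((n : ℝ) - α))) volume := by
  have hn' : (1 : ℝ) ≤ n := by exact_mod_cast hn
  have hp : 0 < (n : ℝ) / (n - α) := div_pos (by linarith) (by linarith)
  intro hmem
  have h := (hmem.integrable_norm_rpow (by simpa using hp) ENNReal.ofReal_ne_top).integrableOn
    (s := Metric.ball 0 (1 / 2))
  rw [ENNReal.toReal_ofReal hp.le] at h
  have h' := h.congr_fun (g := fun x : Euc n => ‖x‖ ^ (-(n : ℝ))) (fun x hx => ?_) measurableSet_ball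
  · rw [integrableOn_ball_norm_rpow_iff hn (by norm_num)] at h'
    simp at h'
  · have hx' : ‖x‖ ≤ 1 / 2 := by simpa using (mem_ball_zero_iff.1 hx).le
    simp only
    rw [witness_eq_rpow hη hx', Real.norm_of_nonneg (by positivity), ← Real.rpow_mul (norm_nonneg _)]
    congr 1
    have : (n : ℝ) - α ≠ 0 := by linarith
    field_simp
    ring

end Witness

/-! ### The principal value defining the fractional divergence -/

section PrincipalValue

variable {n : ℕ} {α : ℝ}

theorem muConst_pos (hα0 : 0 < α) (hα1 : α < 1) : 0 < muConst n α := by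
  unfold muConst
  have h1 : 0 < Real.Gamma (((n : ℝ) + α + 1) / 2) := Real.Gamma_pos_of_pos (by positivity)
  have h2 : 0 < Real.Gamma ((1 - α) / 2) := Real.Gamma_pos_of_pos (by linarith)
  positivity

/-- The integrand `y · v / |y|^{n+α+1}` of the fractional divergence. -/
def divKer (α : ℝ) (y v : Euc n) : ℝ := inner ℝ y v / ‖y‖ ^ ((n : ℝ) + α + 1)

theorem divKer_sub (y v w : Euc n) : divKer α y (v - w) = divKer α y v - divKer α y w := by
  simp [divKer, inner_sub_right, sub_div]

theorem divKer_smul (c : ℝ) (y v : Euc n) : divKer α y (c • v) = c * divKer α y v := by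
  simp [divKer, inner_smul_right, mul_div_assoc]

theorem divKer_neg_left (y v : Euc n) : divKer α (-y) v = -divKer α y v := by
  simp [divKer, neg_div]

theorem measurable_divKer {φ : Euc n → Euc n} (hφ : Measurable φ) :
    Measurable fun y => divKer α y (φ y) := by
  unfold divKer; fun_prop

theorem norm_divKer_le (y v : Euc n) :
    ‖divKer α y v‖ ≤ ‖v‖ * ‖y‖ ^ (-α - n) := by
  rcases eq_or_ne y 0 with rfl | hy
  · simp only [divKer, inner_zero_left, zero_div, norm_zero]; positivity
  have hy0 : 0 < ‖y‖ := norm_pos_iff.2 hy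
  rw [divKer, norm_div, Real.norm_of_nonneg (by positivity : 0 ≤ ‖y‖ ^ ((n : ℝ) + α + 1)),
    div_le_iff₀ (by positivity), mul_assoc, ← Real.rpow_add hy0,
    show -α - n + (n + α + 1) = 1 by ring, Real.rpow_one, mul_comm]
  exact norm_inner_le_norm _ _

/-- A radial majorant of `divKer α y (φ (x + y) - φ x)` for `φ` bounded by `M` with Lipschitz
constant `Λ`. -/
def divMajorant (n : ℕ) (α M Λ : ℝ) (y : Euc n) : ℝ :=
  (Metric.ball 0 1).indicator (fun y : Euc n => Λ * ‖y‖ ^ (1 - α - n)) y +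
    (Metric.ball 0 1)ᶜ.indicator (fun y : Euc n => 2 * M * ‖y‖ ^ (-α - n)) y

theorem integrable_divMajorant (hn : 1 ≤ n) (hα0 : 0 < α) (hα1 : α < 1) (M Λ : ℝ) :
    Integrable (divMajorant n α M Λ) := by
  refine Integrable.add ?_ ?_
  · refine (integrable_indicator_iff measurableSet_ball).2 (Integrable.const_mul ?_ _)
    exact (integrableOn_ball_norm_rpow_iff hn one_pos).2 (by linarith)
  · refine (integrable_indicator_iff measurableSet_ball.compl).2 (Integrable.const_mul ?_ _)
    exact integrableOn_compl_ball_norm_rpow hn hα0 one_pos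

/-- A field bounded by `M` with Lipschitz constant `Λ`. -/
structure IsBddLip (φ : Euc n → Euc n) (M Λ : ℝ) : Prop where
  norm_le : ∀ x, ‖φ x‖ ≤ M
  lip_nonneg : 0 ≤ Λ
  norm_sub_le : ∀ x y, ‖φ x - φ y‖ ≤ Λ * ‖x - y‖

theorem IsBddLip.continuous {φ : Euc n → Euc n} {M Λ : ℝ} (h : IsBddLip φ M Λ) :
    Continuous φ := by
  refine (LipschitzWith.of_dist_le_mul (K := Λ.toNNReal) fun x y => ?_).continuous
  rw [dist_eq_norm, dist_eq_norm]
  refine (h.norm_sub_le x y).trans ?_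
  gcongr
  exact Real.le_coe_toNNReal Λ

variable {φ : Euc n → Euc n} {M Λ : ℝ}

/-- The Lipschitz bound lowers the singularity to |y|^{1-α-n}, integrable at 0; the sup bound leaves
|y|^{-α-n}, integrable at infinity. -/
theorem norm_divKer_sub_le (hφ : IsBddLip φ M Λ) (x y : Euc n) :
    ‖divKer α y (φ (x + y) - φ x)‖ ≤ divMajorant n α M Λ y := by
  refine (norm_divKer_le _ _).trans ?_
  rcases eq_or_ne y 0 with rfl | hy
  · have hΛ : 0 ≤ Λ * ‖(0 : Euc n)‖ ^ (1 - α - n) := mul_nonneg hφ.lip_nonneg (by positivity)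
    simpa [divMajorant] using hΛ
  have hy0 : 0 < ‖y‖ := norm_pos_iff.2 hy
  by_cases h1 : ‖y‖ < 1
  · have := hφ.norm_sub_le (x + y) x
    rw [add_sub_cancel_left] at this
    simp only [divMajorant, Set.indicator, mem_ball_zero_iff, h1, if_true, Set.mem_compl_iff,
      not_true, if_false, add_zero]
    calc _ ≤ Λ * ‖y‖ * ‖y‖ ^ (-α - n) := by gcongr
      _ = _ := by
        rw [show 1 - α - n = (-α - n) + 1 by ring, Real.rpow_add_one hy0.ne']; ring
  · simp only [divMajorant, Set.indicator, mem_ball_zero_iff, h1, if_false, Set.mem_compl_iff,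
      not_false_eq_true, if_true, zero_add]
    gcongr
    linarith [norm_sub_le (φ (x + y)) (φ x), hφ.norm_le x, hφ.norm_le (x + y)]

theorem integrable_divKer_sub (hn : 1 ≤ n) (hα0 : 0 < α) (hα1 : α < 1) (hφ : IsBddLip φ M Λ)
    (x : Euc n) : Integrable fun y => divKer α y (φ (x + y) - φ x) := by
  refine (integrable_divMajorant hn hα0 hα1 M Λ).mono' ?_
    (Eventually.of_forall (norm_divKer_sub_le hφ x))
  have := hφ.continuous
  exact (measurable_divKer (φ := fun y => φ (x + y) - φ x)
    (Continuous.measurable (by fun_prop))).aestronglyMeasurable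

theorem integrableOn_divKer (hn : 1 ≤ n) (hα0 : 0 < α) {ε : ℝ} (hε : 0 < ε)
    {ψ : Euc n → Euc n} (hψ : Measurable ψ) (hM : ∀ x, ‖ψ x‖ ≤ M) :
    IntegrableOn (fun y => divKer α y (ψ y)) {y | ε < ‖y‖} := by
  have h := (integrableOn_compl_ball_norm_rpow hn hα0 hε).mono_set
    (s := {y : Euc n | ε < ‖y‖}) (fun y hy => by simpa using (Set.mem_ofPred.1 hy).le)
  refine (h.const_mul M).mono' (measurable_divKer hψ).aestronglyMeasurable
    (Eventually.of_forall fun y => (norm_divKer_le _ _).trans ?_)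
  gcongr
  exact hM y

theorem measurableSet_lt_norm (ε : ℝ) : MeasurableSet {y : Euc n | ε < ‖y‖} :=
  measurableSet_lt measurable_const measurable_norm

theorem setIntegral_odd {ε : ℝ} {F : Euc n → ℝ} (hF : ∀ y, F (-y) = -F y) :
    ∫ y in {y : Euc n | ε < ‖y‖}, F y = 0 := by
  rw [← integral_indicator (measurableSet_lt_norm ε)]
  set G := {y : Euc n | ε < ‖y‖}.indicator F with hG
  have h := integral_neg_eq_self G volume
  have e : ∀ y, G (-y) = -G y := fun y => by
    by_cases hy : ε < ‖y‖ <;> simp [hG, hy, hF]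
  simp only [e, integral_neg] at h
  linarith

/-- The truncated fractional divergence, without its normalising constant. -/
def truncDiv (α ε : ℝ) (φ : Euc n → Euc n) (x : Euc n) : ℝ :=
  ∫ y in {y : Euc n | ε < ‖y‖}, divKer α y (φ (x + y))

/-- The limit of `truncDiv α ε φ` as `ε → 0`. -/
def pvDiv (α : ℝ) (φ : Euc n → Euc n) (x : Euc n) : ℝ :=
  ∫ y, divKer α y (φ (x + y) - φ x)

/-- The kernel is odd and the truncated region symmetric, so the constant φ(x) may be subtracted for
free. This makes the integrand absolutely integrable and turns the principal value into an ordinary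
integral. -/
theorem truncDiv_eq (hn : 1 ≤ n) (hα0 : 0 < α) (hφ : IsBddLip φ M Λ) {ε : ℝ} (hε : 0 < ε)
    (x : Euc n) :
    truncDiv α ε φ x = ∫ y in {y : Euc n | ε < ‖y‖}, divKer α y (φ (x + y) - φ x) := by
  have hc := hφ.continuous
  simp only [divKer_sub]
  rw [integral_sub, setIntegral_odd (F := fun y => divKer α y (φ x)), sub_zero]
  · rfl
  · exact fun y => divKer_neg_left _ _
  · exact integrableOn_divKer hn hα0 hε (ψ := fun y => φ (x + y))
      (Continuous.measurable (by fun_prop)) (fun y => hφ.norm_le _)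
  · exact integrableOn_divKer hn hα0 hε measurable_const (fun _ => hφ.norm_le x)

theorem norm_truncDiv_le (hn : 1 ≤ n) (hα0 : 0 < α) (hα1 : α < 1) (hφ : IsBddLip φ M Λ)
    {ε : ℝ} (hε : 0 < ε) (x : Euc n) :
    ‖truncDiv α ε φ x‖ ≤ ∫ y, divMajorant n α M Λ y := by
  rw [truncDiv_eq hn hα0 hφ hε, ← integral_indicator (measurableSet_lt_norm ε)]
  refine norm_integral_le_of_norm_le (integrable_divMajorant hn hα0 hα1 M Λ)
    (Eventually.of_forall fun y => ?_)
  refine (norm_indicator_le_norm_self _ _).trans (norm_divKer_sub_le hφ x y)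

theorem norm_pvDiv_le (hn : 1 ≤ n) (hα0 : 0 < α) (hα1 : α < 1) (hφ : IsBddLip φ M Λ)
    (x : Euc n) : ‖pvDiv α φ x‖ ≤ ∫ y, divMajorant n α M Λ y :=
  norm_integral_le_of_norm_le (integrable_divMajorant hn hα0 hα1 M Λ)
    (Eventually.of_forall (norm_divKer_sub_le hφ x))

theorem tendsto_truncDiv (hn : 1 ≤ n) (hα0 : 0 < α) (hα1 : α < 1) (hφ : IsBddLip φ M Λ)
    (x : Euc n) : Tendsto (fun ε => truncDiv α ε φ x) (𝓝[>] 0) (𝓝 (pvDiv α φ x)) := by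
  have h : Tendsto (fun ε => ∫ y, {y : Euc n | ε < ‖y‖}.indicator
      (fun y => divKer α y (φ (x + y) - φ x)) y) (𝓝[>] (0 : ℝ)) (𝓝 (pvDiv α φ x)) := by
    refine tendsto_integral_filter_of_dominated_convergence (divMajorant n α M Λ)
      (Eventually.of_forall fun ε => ?_) (Eventually.of_forall fun ε => ?_)
      (integrable_divMajorant hn hα0 hα1 M Λ) (Eventually.of_forall fun y => ?_)
    · exact (integrable_divKer_sub hn hα0 hα1 hφ x).aestronglyMeasurable.indicator
        (measurableSet_lt_norm ε)
    · exact Eventually.of_forall fun y =>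
        (norm_indicator_le_norm_self _ _).trans (norm_divKer_sub_le hφ x y)
    · rcases eq_or_ne y 0 with rfl | hy
      · simp [divKer, Set.indicator]
      · refine tendsto_const_nhds.congr' ?_
        filter_upwards [nhdsWithin_le_nhds (Iio_mem_nhds (norm_pos_iff.2 hy))] with ε hε
        simp [Set.indicator, Set.mem_Iio.1 hε]
  refine h.congr' ?_
  filter_upwards [self_mem_nhdsWithin] with ε hε
  rw [truncDiv_eq hn hα0 hφ hε, integral_indicator (measurableSet_lt_norm ε)]

theorem fracDiv_eq (hn : 1 ≤ n) (hα0 : 0 < α) (hα1 : α < 1) (hφ : IsBddLip φ M Λ)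
    (x : Euc n) : fracDiv α φ x = muConst n α * pvDiv α φ x := by
  rw [fracDiv]
  congr 1
  exact (tendsto_truncDiv hn hα0 hα1 hφ x).limUnder_eq

theorem continuous_truncDiv (hn : 1 ≤ n) (hα0 : 0 < α) (hφ : IsBddLip φ M Λ) {ε : ℝ}
    (hε : 0 < ε) : Continuous (truncDiv α ε φ) := by
  have hc := hφ.continuous
  have h := (integrableOn_compl_ball_norm_rpow hn hα0 hε).mono_set
    (s := {y : Euc n | ε < ‖y‖}) (fun y hy => by simpa using (Set.mem_ofPred.1 hy).le)
  refine continuous_of_dominated (fun x => ?_) (fun x => ?_) (h.const_mul M)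
    (Eventually.of_forall fun y => ?_)
  · exact (measurable_divKer (φ := fun y => φ (x + y))
      (Continuous.measurable (by fun_prop))).aestronglyMeasurable
  · refine Eventually.of_forall fun y => (norm_divKer_le _ _).trans ?_
    gcongr
    exact hφ.norm_le _
  · unfold divKer; fun_prop

theorem continuous_pvDiv (hn : 1 ≤ n) (hα0 : 0 < α) (hα1 : α < 1) (hφ : IsBddLip φ M Λ) :
    Continuous (pvDiv α φ) := by
  have hc := hφ.continuous
  refine continuous_of_dominated (fun x => ?_)
    (fun x => Eventually.of_forall (norm_divKer_sub_le hφ x))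
    (integrable_divMajorant hn hα0 hα1 M Λ) (Eventually.of_forall fun y => ?_)
  · exact (integrable_divKer_sub hn hα0 hα1 hφ x).aestronglyMeasurable
  · unfold divKer; fun_prop

end PrincipalValue

/-! ### Transfer of the fractional divergence from the field to the function -/

section Duality

variable {n : ℕ} {α : ℝ} {φ : Euc n → Euc n} {M Λ : ℝ}

theorem IsTestField.exists_isBddLip (hφ : IsTestField φ) : ∃ Λ, IsBddLip φ 1 Λ := by
  obtain ⟨C, hC⟩ := hφ.smooth.lipschitzWith_of_hasCompactSupport hφ.compactSupport (by simp)
  refine ⟨C, hφ.norm_le_one, C.2, fun x y => ?_⟩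
  rw [← dist_eq_norm, ← dist_eq_norm]
  exact hC.dist_le_mul x y

theorem tendsto_integral_mul_truncDiv (hn : 1 ≤ n) (hα0 : 0 < α) (hα1 : α < 1)
    (hφ : IsBddLip φ M Λ) {f : Euc n → ℝ} (hf : Integrable f) :
    Tendsto (fun ε => ∫ x, f x * truncDiv α ε φ x) (𝓝[>] 0) (𝓝 (∫ x, f x * pvDiv α φ x)) := by
  refine tendsto_integral_filter_of_dominated_convergence
    (fun x => ‖f x‖ * ∫ y, divMajorant n α M Λ y) ?_ ?_ (hf.norm.mul_const _)
    (Eventually.of_forall fun x => (tendsto_truncDiv hn hα0 hα1 hφ x).const_mul _)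
  · filter_upwards [self_mem_nhdsWithin] with ε hε
    exact hf.aestronglyMeasurable.mul (continuous_truncDiv hn hα0 hφ hε).aestronglyMeasurable
  · filter_upwards [self_mem_nhdsWithin] with ε hε
    refine Eventually.of_forall fun x => ?_
    rw [norm_mul]
    gcongr
    exact norm_truncDiv_le hn hα0 hα1 hφ hε x

/-- Fubini followed by the translation x ↦ x - y. The truncation is what makes the kernel absolutely
integrable; the limit ε → 0 is taken only afterwards. -/
theorem integrable_and_integral_mul_truncDiv (hn : 1 ≤ n) (hα0 : 0 < α)
    (hφ : IsBddLip φ M Λ) {f : Euc n → ℝ} (hf : Integrable f) (hfm : Measurable f) {ε : ℝ}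
    (hε : 0 < ε) :
    Integrable (fun x => ∫ y in {y : Euc n | ε < ‖y‖}, f (x - y) * divKer α y (φ x)) ∧
    ∫ x, f x * truncDiv α ε φ x =
      ∫ x, ∫ y in {y : Euc n | ε < ‖y‖}, f (x - y) * divKer α y (φ x) := by
  have hφm : Measurable φ := hφ.continuous.measurable
  set S := {y : Euc n | ε < ‖y‖}
  set ν : Measure (Euc n) := volume.restrict S
  have hk : Integrable (fun y : Euc n => M * ‖y‖ ^ (-α - n)) ν :=
    ((integrableOn_compl_ball_norm_rpow hn hα0 hε).mono_set
      (fun y hy => by simpa using (Set.mem_ofPred.1 hy).le)).const_mul M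
  have h1 : Integrable (fun z : Euc n × Euc n => f z.1 * divKer α z.2 (φ (z.1 + z.2)))
      (volume.prod ν) := by
    refine (hf.norm.mul_prod hk).mono' ?_ (Eventually.of_forall fun z => ?_)
    · unfold divKer
      exact Measurable.aestronglyMeasurable (by fun_prop)
    · rw [norm_mul]
      gcongr
      refine (norm_divKer_le _ _).trans ?_
      gcongr
      exact hφ.norm_le _
  have htr : ∀ y, ∫ x, f x * divKer α y (φ (x + y)) = ∫ x, f (x - y) * divKer α y (φ x) := by
    intro y
    rw [← integral_add_right_eq_self (μ := volume) (fun x => f (x - y) * divKer α y (φ x)) y]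
    simp
  have h2 : Integrable (fun z : Euc n × Euc n => f (z.1 - z.2) * divKer α z.2 (φ z.1))
      (volume.prod ν) := by
    have hm : AEStronglyMeasurable
        (fun z : Euc n × Euc n => f (z.1 - z.2) * divKer α z.2 (φ z.1)) (volume.prod ν) := by
      unfold divKer
      exact Measurable.aestronglyMeasurable (by fun_prop)
    -- For fixed y the slice in x is a translate of the slice of `h1`, so both slicewise conditions
    -- carry over.
    rw [integrable_prod_iff' hm]
    constructor
    · filter_upwards [h1.prod_left_ae] with y hy
      simpa using hy.comp_sub_right y
    · refine h1.integral_norm_prod_right.congr (Eventually.of_forall fun y => ?_)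
      simp only
      rw [← integral_add_right_eq_self (μ := volume) (fun x => ‖f (x - y) * divKer α y (φ x)‖) y]
      simp
  refine ⟨h2.integral_prod_left, ?_⟩
  calc ∫ x, f x * truncDiv α ε φ x = ∫ x, ∫ y, f x * divKer α y (φ (x + y)) ∂ν := by
        simp only [integral_const_mul]; rfl
    _ = ∫ y, (∫ x, f x * divKer α y (φ (x + y))) ∂ν := integral_integral_swap h1
    _ = ∫ y, (∫ x, f (x - y) * divKer α y (φ x)) ∂ν := by simp only [htr]
    _ = _ := (integral_integral_swap h2).symm

end Duality

/-! ### The witness has infinite variation -/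

section WitnessVariation

variable {n : ℕ} {α : ℝ} {η : ℝ → ℝ} {L : ℝ≥0}

theorem norm_sub_le_norm_add_iff (x y : Euc n) : ‖x - y‖ ≤ ‖x + y‖ ↔ 0 ≤ inner ℝ y x := by
  rw [← sq_le_sq₀ (norm_nonneg _) (norm_nonneg _), norm_sub_sq_real, norm_add_sq_real,
    real_inner_comm]
  constructor <;> intro h <;> linarith

/-- Both factors have the sign of y · x. The points y = ±x are excluded because there the convention
for powers of zero would replace an infinite value by a finite one. -/
theorem rpow_sub_mul_divKer_nonneg (hαn : α ≤ n) {x y : Euc n} (h1 : y ≠ x) (h2 : y ≠ -x) :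
    0 ≤ (‖x - y‖ ^ (α - n) - ‖x + y‖ ^ (α - n)) * divKer α y (‖x‖⁻¹ • x) := by
  have hs : 0 < ‖x - y‖ := norm_pos_iff.2 (sub_ne_zero.2 h1.symm)
  have ha : 0 < ‖x + y‖ := norm_pos_iff.2 (fun h => h2 (by rw [eq_neg_iff_add_eq_zero, add_comm, h]))
  have hk : divKer α y (‖x‖⁻¹ • x) = ‖x‖⁻¹ * (inner ℝ y x / ‖y‖ ^ ((n : ℝ) + α + 1)) :=
    divKer_smul _ _ _
  rw [hk]
  rcases le_total 0 (inner ℝ y x) with h | h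
  · have := Real.rpow_le_rpow_of_nonpos hs ((norm_sub_le_norm_add_iff x y).2 h)
      (show α - n ≤ 0 by linarith)
    exact mul_nonneg (by linarith) (by positivity)
  · have h' : ‖x + y‖ ≤ ‖x - y‖ := by
      have := (norm_sub_le_norm_add_iff x (-y)).2 (by simpa using h)
      simpa [← sub_eq_add_neg] using this
    have := Real.rpow_le_rpow_of_nonpos ha h' (show α - n ≤ 0 by linarith)
    refine mul_nonneg_of_nonpos_of_nonpos (by linarith) ?_
    exact mul_nonpos_of_nonneg_of_nonpos (by positivity)
      (div_nonpos_of_nonpos_of_nonneg h (by positivity))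

/-- Here |x - y| ≤ |x|/2, so its power is at least 2^{n-α}|x|^{α-n}, and α + 1 ≤ n makes this at
least twice |x|^{α-n}; as |x + y| ≥ |x|, the difference keeps one copy. The kernel contributes |x| ·
|x|^{-(n+α+1)}, and the exponents add to -2n. -/
theorem rpow_sub_mul_divKer_ge (hαn : α + 1 ≤ n) (hα0 : 0 < α) {x y : Euc n} (hx : x ≠ 0)
    (hxy : y ≠ x) (hy : ‖y - x‖ < ‖x‖ / 2) :
    1 / 2 * (3 / 2 : ℝ) ^ (-((n : ℝ) + α + 1)) * ‖x‖ ^ (-(2 * n : ℝ)) ≤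
      (‖x - y‖ ^ (α - n) - ‖x + y‖ ^ (α - n)) * divKer α y (‖x‖⁻¹ • x) := by
  have hx0 : 0 < ‖x‖ := norm_pos_iff.2 hx
  have hs : 0 < ‖x - y‖ := norm_pos_iff.2 (sub_ne_zero.2 hxy.symm)
  have hs' : ‖x - y‖ ≤ ‖x‖ / 2 := by rw [norm_sub_rev]; exact hy.le
  have hy1 : ‖y‖ ≤ 3 / 2 * ‖x‖ := by
    have := norm_add_le (y - x) x; rw [sub_add_cancel] at this; linarith
  have hy0 : 0 < ‖y‖ := by
    have := norm_sub_norm_le x (x - y); rw [sub_sub_cancel] at this; linarith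
  have ha : ‖x‖ ≤ ‖x + y‖ := by
    have h1 := norm_sub_norm_le ((2 : ℝ) • x) (-(y - x))
    rw [show (2 : ℝ) • x - -(y - x) = x + y by module, norm_neg, norm_smul] at h1
    norm_num at h1
    linarith
  have hin : ‖x‖ ^ 2 / 2 ≤ inner ℝ y x := by
    have h1 : inner ℝ y x = ‖x‖ ^ 2 + inner ℝ (y - x) x := by
      rw [inner_sub_left, real_inner_self_eq_norm_sq]; ring
    have h2 := abs_le.1 (abs_real_inner_le_norm (y - x) x)
    nlinarith
  have hd : ‖x‖ ^ (α - n) ≤ ‖x - y‖ ^ (α - n) - ‖x + y‖ ^ (α - n) := by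
    have h1 : ‖x + y‖ ^ (α - n) ≤ ‖x‖ ^ (α - n) :=
      Real.rpow_le_rpow_of_nonpos hx0 ha (by linarith)
    have h2 : (‖x‖ / 2) ^ (α - n) ≤ ‖x - y‖ ^ (α - n) :=
      Real.rpow_le_rpow_of_nonpos hs hs' (by linarith)
    have h3 : (‖x‖ / 2) ^ (α - n) = 2 ^ (n - α) * ‖x‖ ^ (α - n) := by
      rw [Real.div_rpow hx0.le (by norm_num), ← neg_sub (n : ℝ) α,
        Real.rpow_neg (by norm_num : (0 : ℝ) ≤ 2)]
      field_simp
    have h4 : (2 : ℝ) ≤ 2 ^ (n - α) := by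
      calc (2 : ℝ) = 2 ^ (1 : ℝ) := (Real.rpow_one 2).symm
        _ ≤ _ := Real.rpow_le_rpow_of_exponent_le (by norm_num) (by linarith)
    have h5 : 0 < ‖x‖ ^ (α - n) := by positivity
    nlinarith
  have hk : 1 / 2 * ‖x‖ * (3 / 2 * ‖x‖) ^ (-((n : ℝ) + α + 1)) ≤ divKer α y (‖x‖⁻¹ • x) := by
    rw [divKer, inner_smul_right, div_eq_mul_inv (‖x‖⁻¹ * inner ℝ y x), ← Real.rpow_neg (norm_nonneg y)]
    have h1 : (3 / 2 * ‖x‖) ^ (-((n : ℝ) + α + 1)) ≤ ‖y‖ ^ (-((n : ℝ) + α + 1)) :=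
      Real.rpow_le_rpow_of_nonpos hy0 hy1 (by linarith)
    have h2 : 1 / 2 * ‖x‖ ≤ ‖x‖⁻¹ * inner ℝ y x := by
      rw [inv_mul_eq_div, le_div_iff₀ hx0]; nlinarith
    exact mul_le_mul h2 h1 (by positivity) (le_trans (by positivity) h2)
  calc _ = ‖x‖ ^ (α - n) * (1 / 2 * ‖x‖ * (3 / 2 * ‖x‖) ^ (-((n : ℝ) + α + 1))) := by
        rw [Real.mul_rpow (by norm_num) hx0.le]
        have : ‖x‖ ^ (-(2 * n : ℝ)) =
            ‖x‖ ^ (α - n) * (‖x‖ * ‖x‖ ^ (-((n : ℝ) + α + 1))) := by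
          nth_rewrite 3 [← Real.rpow_one ‖x‖]
          rw [← Real.rpow_add hx0, ← Real.rpow_add hx0]
          congr 1; ring
        rw [this]; ring
    _ ≤ _ := mul_le_mul hd hk (by positivity) (le_trans (by positivity) hd)

/-- The truncated fractional derivative of the witness in the radial direction is large near the
origin. -/
theorem exists_setIntegral_witness_ge (hn : 2 ≤ n) (hα0 : 0 < α) (hα1 : α < 1)
    (hη : IsRadialCutoff η L) :
    ∃ c C : ℝ, 0 < c ∧ 0 ≤ C ∧ ∀ (x : Euc n) (ε : ℝ), 0 < ε → ε < ‖x‖ / 2 → ‖x‖ < 1 / 8 →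
      c * ‖x‖ ^ (-(n : ℝ)) - C ≤
        ∫ y in {y : Euc n | ε < ‖y‖}, witness n α η (x - y) * divKer α y (‖x‖⁻¹ • x) := by
  have hn' : (2 : ℝ) ≤ n := by exact_mod_cast hn
  have : Nontrivial (Euc n) := Module.nontrivial_of_finrank_pos (R := ℝ) (by simp; omega)
  set f := witness n α η with hf
  have hfi : Integrable f := integrable_witness (by omega) hα0 hη
  set c₀ : ℝ := 1 / 2 * (3 / 2 : ℝ) ^ (-((n : ℝ) + α + 1))
  set V : ℝ := volume.real (Metric.ball (0 : Euc n) 1)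
  have hV : 0 < V := ENNReal.toReal_pos (Metric.measure_ball_pos _ _ one_pos).ne'
    measure_ball_lt_top.ne
  set D : ℝ := (1 / 4 : ℝ) ^ (-α - n)
  set I : ℝ := ∫ x, f x
  have hI : 0 ≤ I := integral_nonneg fun x => witness_nonneg hη x
  -- (1/2)^n V |x|^n is the volume of the ball of radius |x|/2, the final division by 2 undoes the
  -- symmetrisation, and D bounds the kernel for |y| ≥ 1/4.
  refine ⟨c₀ * (1 / 2) ^ n * V / 2, D * I, by positivity, by positivity, ?_⟩
  intro x ε hε hεx hx8
  have hx0 : 0 < ‖x‖ := by linarith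
  have hxne : x ≠ 0 := norm_pos_iff.1 hx0
  set S := {y : Euc n | ε < ‖y‖} with hS
  set e : Euc n := ‖x‖⁻¹ • x with he
  have hen : ‖e‖ = 1 := by rw [he, norm_smul, norm_inv, norm_norm, inv_mul_cancel₀ hx0.ne']
  have hkb : ∀ r > 0, ∀ y : Euc n, r ≤ ‖y‖ → ‖divKer α y e‖ ≤ r ^ (-α - n) := fun r hr y hy => by
    refine (norm_divKer_le y e).trans ?_
    rw [hen, one_mul]
    exact Real.rpow_le_rpow_of_nonpos hr hy (by linarith)
  have hkm : Measurable fun y : Euc n => divKer α y e := measurable_divKer measurable_const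
  have hshift : ∀ g : Euc n → ℝ, Integrable g →
      IntegrableOn (fun y => g y * divKer α y e) S := fun g hg => by
    refine Integrable.mono' (hg.norm.mul_const (ε ^ (-α - n))).integrableOn
      (hg.aestronglyMeasurable.mul hkm.aestronglyMeasurable).restrict ?_
    filter_upwards [ae_restrict_mem (measurableSet_lt_norm ε)] with y hy
    rw [norm_mul]
    gcongr
    exact hkb ε hε y (Set.mem_ofPred.1 hy).le
  have hi1 : Integrable fun y => f (x - y) := hfi.comp_sub_left x
  have hi2 : Integrable fun y => f (x + y) := hfi.comp_add_left x
  have hodd : ∫ y in S, f (x + y) * divKer α y e = -∫ y in S, f (x - y) * divKer α y e := by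
    rw [← integral_indicator (measurableSet_lt_norm ε),
      ← integral_indicator (measurableSet_lt_norm ε), ← integral_neg, ← integral_neg_eq_self]
    congr 1; ext y
    by_cases hy : ε < ‖y‖ <;>
      simp [hy, divKer_neg_left, sub_eq_add_neg]
  -- Averaging with y ↦ -y exposes the difference f(x - y) - f(x + y), whose sign agrees with that
  -- of the kernel near the origin.
  have hsym : 2 * ∫ y in S, f (x - y) * divKer α y e =
      ∫ y in S, (f (x - y) - f (x + y)) * divKer α y e := by
    simp only [sub_mul]
    rw [integral_sub (hshift _ hi1) (hshift _ hi2), hodd]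
    ring
  set b : Euc n → ℝ := (Metric.ball x (‖x‖ / 2)).indicator
    fun _ => c₀ * ‖x‖ ^ (-(2 * n : ℝ)) with hb
  have hbi : Integrable b := (integrable_indicator_iff measurableSet_ball).2
    (integrableOn_const measure_ball_lt_top.ne)
  have hbS : ∫ y in S, b y = c₀ * (1 / 2) ^ n * V * ‖x‖ ^ (-(n : ℝ)) := by
    have hsub : Metric.ball x (‖x‖ / 2) ⊆ S := fun y hy => by
      have h1 : ‖y - x‖ < ‖x‖ / 2 := by simpa [dist_eq_norm] using hy
      have h2 := norm_sub_norm_le x (x - y)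
      rw [sub_sub_cancel, norm_sub_rev] at h2
      exact lt_of_lt_of_le hεx (by linarith)
    rw [setIntegral_indicator measurableSet_ball, Set.inter_eq_right.2 hsub, setIntegral_const,
      Measure.real, Measure.addHaar_ball _ _ (by positivity), ENNReal.toReal_mul,
      ENNReal.toReal_ofReal (by positivity), finrank_euclideanSpace_fin, smul_eq_mul,
      show -(n : ℝ) = n + -(2 * n) by ring, Real.rpow_add hx0, Real.rpow_natCast, div_pow, div_pow, one_pow]
    simp only [V, Measure.real]
    ring
  set T : Euc n → ℝ := fun y => f (x - y) + f (x + y)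
  have hTi : Integrable T := hi1.add hi2
  have hT : ∫ y in S, T y ≤ 2 * I := by
    refine (setIntegral_le_integral hTi (Eventually.of_forall fun y =>
      add_nonneg (witness_nonneg hη _) (witness_nonneg hη _))).trans ?_
    simp only [T]
    rw [integral_add hi1 hi2, integral_sub_left_eq_self f volume x,
      integral_add_left_eq_self f x]
    linarith
  have hpt : ∀ᵐ y ∂(volume.restrict S),
      b y - D * T y ≤ (f (x - y) - f (x + y)) * divKer α y e := by
    have h1 : ∀ᵐ y : Euc n, y ≠ x := by simp [ae_iff]
    have h2 : ∀ᵐ y : Euc n, y ≠ -x := by simp [ae_iff]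
    refine ae_restrict_of_ae ?_
    filter_upwards [h1, h2] with y hy1 hy2
    have hT0 : 0 ≤ D * T y := mul_nonneg (by positivity)
      (add_nonneg (witness_nonneg hη _) (witness_nonneg hη _))
    -- As |x| < 1/8, both x - y and x + y then lie in the ball where the witness is the pure power.
    -- For larger y no sign is available, and the bounded kernel times f(x - y) + f(x + y) is
    -- charged to D * T.
    by_cases hy4 : ‖y‖ < 1 / 4
    · rw [hf, witness_eq_rpow hη (by linarith [norm_sub_le x y]),
        witness_eq_rpow hη (by linarith [norm_add_le x y])]
      by_cases hyb : y ∈ Metric.ball x (‖x‖ / 2)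
      · have : c₀ * ‖x‖ ^ (-(2 * n : ℝ)) ≤
            (‖x - y‖ ^ (α - n) - ‖x + y‖ ^ (α - n)) * divKer α y e :=
          rpow_sub_mul_divKer_ge (by linarith) hα0 hxne hy1
          (by simpa [dist_eq_norm] using hyb)
        rw [hb, Set.indicator_of_mem hyb]
        linarith
      · have := rpow_sub_mul_divKer_nonneg (α := α) (by linarith) hy1 hy2
        rw [hb, Set.indicator_of_notMem hyb]
        linarith
    · have hyb : y ∉ Metric.ball x (‖x‖ / 2) := fun hyb => hy4 (by
        have h1 : ‖y - x‖ < ‖x‖ / 2 := by simpa [dist_eq_norm] using hyb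
        have := norm_add_le (y - x) x; rw [sub_add_cancel] at this; linarith)
      rw [hb, Set.indicator_of_notMem hyb, zero_sub]
      refine neg_le_of_abs_le ?_
      rw [abs_mul, mul_comm]
      refine mul_le_mul (hkb _ (by norm_num) y (not_lt.1 hy4)) ?_ (abs_nonneg _) (by positivity)
      refine (abs_sub _ _).trans ?_
      rw [abs_of_nonneg (witness_nonneg hη _), abs_of_nonneg (witness_nonneg hη _)]
  have hmono := integral_mono_ae (hbi.integrableOn.sub (hTi.const_mul D).integrableOn)
    (hshift _ (hi1.sub hi2)) hpt
  simp only [Pi.sub_apply] at hmono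
  rw [integral_sub hbi.integrableOn (hTi.const_mul D).integrableOn, hbS, integral_const_mul,
    ← hsym] at hmono
  have : D * ∫ y in S, T y ≤ D * (2 * I) := by gcongr
  linarith

/-- A smooth cut-off supported in a thin shell around the origin. -/
structure IsShellBump (δ : ℝ) (ψ : Euc n → ℝ) : Prop where
  smooth : ContDiff ℝ ∞ ψ
  nonneg : ∀ x, 0 ≤ ψ x
  le_one : ∀ x, ψ x ≤ 1
  eq_zero_of_le : ∀ x, ‖x‖ ≤ δ / 2 → ψ x = 0
  eq_zero_of_ge : ∀ x, 1 / 8 ≤ ‖x‖ → ψ x = 0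
  eq_one : ∀ x, δ ≤ ‖x‖ → ‖x‖ ≤ 1 / 16 → ψ x = 1

theorem exists_isShellBump {δ : ℝ} (hδ : 0 < δ) : ∃ ψ : Euc n → ℝ, IsShellBump δ ψ := by
  -- Using |x|² keeps both factors smooth at the origin. The first rises over δ/2 ≤ |x| ≤ δ, where
  -- |x|² grows by 3δ²/4; the second falls over 1/16 ≤ |x| ≤ 1/8, where |x|² grows by 3/256.
  refine ⟨fun x => Real.smoothTransition ((‖x‖ ^ 2 - δ ^ 2 / 4) / (3 * δ ^ 2 / 4)) *
    Real.smoothTransition ((1 / 64 - ‖x‖ ^ 2) / (3 / 256)), ?_, ?_, ?_, ?_, ?_, ?_⟩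
  · have h : ContDiff ℝ ∞ fun x : Euc n => ‖x‖ ^ 2 := contDiff_norm_sq ℝ
    refine ContDiff.mul ?_ ?_
    · exact Real.smoothTransition.contDiff.comp ((h.sub contDiff_const).div_const _)
    · exact Real.smoothTransition.contDiff.comp ((contDiff_const.sub h).div_const _)
  · exact fun x => mul_nonneg (Real.smoothTransition.nonneg _) (Real.smoothTransition.nonneg _)
  · exact fun x => mul_le_one₀ (Real.smoothTransition.le_one _) (Real.smoothTransition.nonneg _)
      (Real.smoothTransition.le_one _)
  · intro x hx
    have : ‖x‖ ^ 2 ≤ (δ / 2) ^ 2 := by gcongr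
    rw [Real.smoothTransition.zero_of_nonpos, zero_mul]
    exact div_nonpos_of_nonpos_of_nonneg (by linarith) (by positivity)
  · intro x hx
    have : (1 / 8 : ℝ) ^ 2 ≤ ‖x‖ ^ 2 := by gcongr
    rw [mul_comm, Real.smoothTransition.zero_of_nonpos, zero_mul]
    exact div_nonpos_of_nonpos_of_nonneg (by linarith) (by positivity)
  · intro x hx hx'
    have h1 : δ ^ 2 ≤ ‖x‖ ^ 2 := by gcongr
    have h2 : ‖x‖ ^ 2 ≤ (1 / 16) ^ 2 := by gcongr
    rw [Real.smoothTransition.one_of_one_le, Real.smoothTransition.one_of_one_le, one_mul]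
    · rw [le_div_iff₀ (by norm_num)]; linarith
    · rw [le_div_iff₀ (by positivity)]; linarith

/-- x/|x| is singular only at 0, where ψ vanishes on a neighbourhood. -/
theorem IsShellBump.isTestField {δ : ℝ} (hδ : 0 < δ) {ψ : Euc n → ℝ} (hψ : IsShellBump δ ψ) :
    IsTestField fun x => ψ x • (‖x‖⁻¹ • x) where
  smooth := by
    rw [contDiff_iff_contDiffAt]
    intro x
    rcases eq_or_ne x 0 with rfl | hx
    · refine (contDiffAt_const (c := (0 : Euc n))).congr_of_eventuallyEq ?_
      filter_upwards [Metric.ball_mem_nhds (0 : Euc n) (half_pos hδ)] with y hy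
      rw [hψ.eq_zero_of_le y (mem_ball_zero_iff.1 hy).le, zero_smul]
    · exact hψ.smooth.contDiffAt.smul
        (((contDiffAt_norm ℝ hx).inv (norm_ne_zero_iff.2 hx)).smul contDiffAt_id)
  compactSupport := by
    refine HasCompactSupport.intro (isCompact_closedBall (0 : Euc n) (1 / 8)) fun x hx => ?_
    rw [hψ.eq_zero_of_ge x, zero_smul]
    simpa using (not_le.1 (mt mem_closedBall_zero_iff.2 hx)).le
  norm_le_one x := by
    rw [norm_smul, Real.norm_of_nonneg (hψ.nonneg x), norm_smul, norm_inv, norm_norm]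
    refine mul_le_one₀ (hψ.le_one x) (by positivity) ?_
    rcases eq_or_ne x 0 with rfl | hx
    · simp
    · rw [inv_mul_cancel₀ (norm_ne_zero_iff.2 hx)]

theorem IsShellBump.integrable {δ : ℝ} {ψ : Euc n → ℝ} (hψ : IsShellBump δ ψ) :
    Integrable ψ := by
  refine hψ.smooth.continuous.integrable_of_hasCompactSupport ?_
  refine HasCompactSupport.intro (isCompact_closedBall (0 : Euc n) (1 / 8)) fun x hx => ?_
  exact hψ.eq_zero_of_ge x (by simpa using (not_le.1 (mt mem_closedBall_zero_iff.2 hx)).le)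

theorem IsShellBump.integrable_mul_rpow {δ : ℝ} (hδ : 0 < δ) {ψ : Euc n → ℝ}
    (hψ : IsShellBump δ ψ) : Integrable fun x => ψ x * ‖x‖ ^ (-(n : ℝ)) := by
  refine (hψ.integrable.mul_const ((δ / 2) ^ (-(n : ℝ)))).mono' ?_
    (Eventually.of_forall fun x => ?_)
  · have := hψ.smooth.continuous.measurable
    exact Measurable.aestronglyMeasurable (by fun_prop)
  · rw [Real.norm_of_nonneg (mul_nonneg (hψ.nonneg x) (by positivity))]
    by_cases hx : ‖x‖ ≤ δ / 2
    · simp [hψ.eq_zero_of_le x hx]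
    · refine mul_le_mul_of_nonneg_left ?_ (hψ.nonneg x)
      exact Real.rpow_le_rpow_of_nonpos (half_pos hδ) (not_le.1 hx).le (by simp)

theorem IsShellBump.integral_le {δ : ℝ} {ψ : Euc n → ℝ} (hψ : IsShellBump δ ψ) :
    ∫ x, ψ x ≤ volume.real (Metric.ball (0 : Euc n) (1 / 8)) := by
  have h : ∫ x, (Metric.ball (0 : Euc n) (1 / 8)).indicator (fun _ => (1 : ℝ)) x =
      volume.real (Metric.ball (0 : Euc n) (1 / 8)) := by
    rw [integral_indicator measurableSet_ball]; simp
  rw [← h]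
  refine integral_mono hψ.integrable ((integrable_indicator_iff measurableSet_ball).2
    (integrableOn_const measure_ball_lt_top.ne)) fun x => ?_
  by_cases hx : ‖x‖ < 1 / 8
  · rw [Set.indicator_of_mem (mem_ball_zero_iff.2 hx)]; exact hψ.le_one x
  · rw [Set.indicator_of_notMem (mt mem_ball_zero_iff.1 hx), hψ.eq_zero_of_ge x (not_lt.1 hx)]

/-- Finite variation bounds the pairing with the radial field ψ(x) x/|x| from above, the pointwise
estimate bounds it from below. The point is that A does not depend on δ. -/
theorem exists_integral_shellBump_le (hn : 2 ≤ n) (hα0 : 0 < α) (hα1 : α < 1)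
    (hη : IsRadialCutoff η L) (hbv : fracVariation α (witness n α η) < ⊤) :
    ∃ A : ℝ, ∀ δ > 0, ∀ ψ : Euc n → ℝ, IsShellBump δ ψ → ∫ x, ψ x * ‖x‖ ^ (-(n : ℝ)) ≤ A := by
  obtain ⟨c, C, hc, hC, hcC⟩ := exists_setIntegral_witness_ge hn hα0 hα1 hη
  have hn1 : 1 ≤ n := by omega
  set f := witness n α η
  have hfi : Integrable f := integrable_witness hn1 hα0 hη
  set V := (fracVariation α f).toReal
  have hμ : 0 < muConst n α := muConst_pos hα0 hα1
  refine ⟨((muConst n α)⁻¹ * V + C * volume.real (Metric.ball (0 : Euc n) (1 / 8))) / c, ?_⟩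
  intro δ hδ ψ hψ
  have hφ := hψ.isTestField hδ
  set φ : Euc n → Euc n := fun x => ψ x • (‖x‖⁻¹ • x) with hφd
  obtain ⟨Λ, hΛ⟩ := hφ.exists_isBddLip
  have hV : ∫ x, f x * fracDiv α φ x ≤ V := by
    have h1 : ENNReal.ofReal (∫ x, f x * fracDiv α φ x) ≤ fracVariation α f :=
      le_iSup₂_of_le φ hφ le_rfl
    exact (ENNReal.ofReal_le_iff_le_toReal hbv.ne).1 h1
  have hV' : ∫ x, f x * pvDiv α φ x ≤ (muConst n α)⁻¹ * V := by
    simp only [fracDiv_eq hn1 hα0 hα1 hΛ] at hV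
    rw [show (fun x => f x * (muConst n α * pvDiv α φ x)) =
      fun x => muConst n α * (f x * pvDiv α φ x) by ext; ring, integral_const_mul] at hV
    rwa [inv_mul_eq_div, le_div_iff₀ hμ, mul_comm]
  have hlow : c * (∫ x, ψ x * ‖x‖ ^ (-(n : ℝ))) - C * ∫ x, ψ x ≤ ∫ x, f x * pvDiv α φ x := by
    refine ge_of_tendsto (tendsto_integral_mul_truncDiv hn1 hα0 hα1 hΛ hfi) ?_
    -- Where ψ is nonzero |x| > δ/2, so ε < δ/4 guarantees ε < |x|/2.
    filter_upwards [self_mem_nhdsWithin,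
      nhdsWithin_le_nhds (Iio_mem_nhds (show 0 < δ / 4 by positivity))] with ε hε0 hεδ
    have hε0' : 0 < ε := hε0
    have hεδ' : ε < δ / 4 := hεδ
    obtain ⟨hdom, heq⟩ := integrable_and_integral_mul_truncDiv hn1 hα0 hΛ hfi
      (measurable_witness hη) hε0'
    have h1 := (hψ.integrable_mul_rpow hδ).const_mul c
    have h2 := hψ.integrable.const_mul C
    rw [heq, ← integral_const_mul, ← integral_const_mul, ← integral_sub h1 h2]
    refine integral_mono (h1.sub h2) hdom fun x => ?_
    simp only [hφd, divKer_smul (ψ x)]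
    rw [show (fun y => f (x - y) * (ψ x * divKer α y (‖x‖⁻¹ • x))) =
      fun y => ψ x * (f (x - y) * divKer α y (‖x‖⁻¹ • x)) by ext; ring, integral_const_mul]
    by_cases hx1 : ‖x‖ ≤ δ / 2
    · simp [hψ.eq_zero_of_le x hx1]
    by_cases hx2 : 1 / 8 ≤ ‖x‖
    · simp [hψ.eq_zero_of_ge x hx2]
    have := hcC x ε hε0' (by linarith) (not_le.1 hx2)
    calc _ = ψ x * (c * ‖x‖ ^ (-(n : ℝ)) - C) := by ring
      _ ≤ _ := mul_le_mul_of_nonneg_left this (hψ.nonneg x)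
  have h3 : C * ∫ x, ψ x ≤ C * volume.real (Metric.ball (0 : Euc n) (1 / 8)) := by
    gcongr
    exact hψ.integral_le
  rw [le_div_iff₀ hc]
  linarith

/-- The uniform bound over shells with δ = 1/(k+1) would make |x|^{-n} integrable near 0. -/
theorem witness_notMem_BVSpace (hn : 2 ≤ n) (hα0 : 0 < α) (hα1 : α < 1)
    (hη : IsRadialCutoff η L) : witness n α η ∉ BVSpace n α := by
  rintro ⟨-, hbv⟩
  obtain ⟨A, hA⟩ := exists_integral_shellBump_le hn hα0 hα1 hη hbv
  have : Nontrivial (Euc n) := Module.nontrivial_of_finrank_pos (R := ℝ) (by simp; omega)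
  suffices h : IntegrableOn (fun x : Euc n => ‖x‖ ^ (-(n : ℝ))) (Metric.ball 0 (1 / 16)) by
    rw [integrableOn_ball_norm_rpow_iff (by omega) (by norm_num)] at h
    simp at h
  set μ : Measure (Euc n) := volume.restrict (Metric.ball 0 (1 / 16))
  have hcover : AECover μ atTop fun k : ℕ => {x : Euc n | 1 / ((k : ℝ) + 1) < ‖x‖} := by
    refine ⟨?_, fun k => measurableSet_lt_norm _⟩
    have h0 : ∀ᵐ x ∂(volume : Measure (Euc n)), x ≠ 0 := by simp [ae_iff]
    filter_upwards [ae_restrict_of_ae h0] with x hx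
    exact (tendsto_order.1 tendsto_one_div_add_atTop_nhds_zero_nat).2 _ (norm_pos_iff.2 hx)
  have hmeas : Measurable fun x : Euc n => ‖x‖ ^ (-(n : ℝ)) := by fun_prop
  refine hcover.integrable_of_integral_norm_bounded A (fun k => ?_) (Eventually.of_forall fun k => ?_)
  · have hk : (0 : ℝ) < 1 / ((k : ℝ) + 1) := by positivity
    have : IsFiniteMeasure μ := ⟨by simpa [μ] using measure_ball_lt_top⟩
    refine (integrable_const ((1 / ((k : ℝ) + 1)) ^ (-(n : ℝ)))).mono'
      hmeas.aestronglyMeasurable ?_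
    filter_upwards [ae_restrict_mem (measurableSet_lt_norm _)] with x hx
    rw [Real.norm_of_nonneg (by positivity)]
    have hx' : 1 / ((k : ℝ) + 1) < ‖x‖ := hx
    exact Real.rpow_le_rpow_of_nonpos hk hx'.le (by simp)
  · have hk : (0 : ℝ) < 1 / ((k : ℝ) + 1) := by positivity
    obtain ⟨ψ, hψ⟩ := exists_isShellBump (n := n) hk
    refine le_trans ?_ (hA _ hk ψ hψ)
    rw [← integral_indicator (measurableSet_lt_norm _), ← integral_indicator measurableSet_ball]
    refine integral_mono_of_nonneg (Eventually.of_forall fun x => ?_)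
      (hψ.integrable_mul_rpow hk) (Eventually.of_forall fun x => ?_)
    · exact Set.indicator_nonneg (fun _ _ => Set.indicator_nonneg (fun _ _ => norm_nonneg _) _) _
    · have hr : 0 ≤ ψ x * ‖x‖ ^ (-(n : ℝ)) := mul_nonneg (hψ.nonneg x) (by positivity)
      change _ ≤ ψ x * ‖x‖ ^ (-(n : ℝ))
      by_cases hx : ‖x‖ < 1 / 16
      · by_cases hx' : 1 / ((k : ℝ) + 1) < ‖x‖
        · rw [Set.indicator_of_mem (mem_ball_zero_iff.2 hx), Set.indicator_of_mem (by exact hx'),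
            hψ.eq_one x hx'.le hx.le, one_mul, Real.norm_of_nonneg (by positivity)]
        · rw [Set.indicator_of_mem (mem_ball_zero_iff.2 hx), Set.indicator_of_notMem (by exact hx')]
          exact hr
      · rw [Set.indicator_of_notMem (mt mem_ball_zero_iff.1 hx)]
        exact hr

end WitnessVariation

/-! ### Gaussian integrals -/

section Gaussian

variable {n : ℕ}

theorem integrable_norm_pow_mul_gauss (hn : 1 ≤ n) (j : ℕ) {κ : ℝ} (hκ : 0 < κ) :
    Integrable fun w : Euc n => ‖w‖ ^ j * Real.exp (-κ * ‖w‖ ^ 2) := by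
  have : Nontrivial (Euc n) := Module.nontrivial_of_finrank_pos (R := ℝ) (by simp; omega)
  rw [integrable_fun_norm_addHaar volume (f := fun y : ℝ => y ^ j * Real.exp (-κ * y ^ 2))]
  have h := integrableOn_rpow_mul_exp_neg_mul_sq hκ
    (s := ((n - 1 + j : ℕ) : ℝ)) (by linarith [Nat.cast_nonneg (α := ℝ) (n - 1 + j)])
  refine h.congr_fun (fun y _ => ?_) measurableSet_Ioi
  simp only [finrank_euclideanSpace_fin, smul_eq_mul, Real.rpow_natCast, pow_add, mul_assoc]

/-- The constants in the moments of a Gaussian. -/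
def gaussMoment (n j : ℕ) : ℝ := sphereArea n / 2 * Real.Gamma (((n : ℝ) + j) / 2)

theorem integral_norm_pow_mul_gauss (hn : 1 ≤ n) (j : ℕ) {κ : ℝ} (hκ : 0 < κ) :
    ∫ w : Euc n, ‖w‖ ^ j * Real.exp (-κ * ‖w‖ ^ 2) =
      gaussMoment n j * κ ^ (-(((n : ℝ) + j) / 2)) := by
  have : Nontrivial (Euc n) := Module.nontrivial_of_finrank_pos (R := ℝ) (by simp; omega)
  rw [integral_fun_norm_addHaar volume (fun y : ℝ => y ^ j * Real.exp (-κ * y ^ 2))]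
  have e : ∫ y in Set.Ioi (0 : ℝ), y ^ (Module.finrank ℝ (Euc n) - 1) •
      (y ^ j * Real.exp (-κ * y ^ 2)) =
      ∫ y in Set.Ioi (0 : ℝ), y ^ ((n - 1 + j : ℕ) : ℝ) * Real.exp (-κ * y ^ (2 : ℝ)) := by
    refine setIntegral_congr_fun measurableSet_Ioi fun y _ => ?_
    simp only [finrank_euclideanSpace_fin, smul_eq_mul, Real.rpow_natCast, pow_add, mul_assoc,
      Real.rpow_two]
  rw [e, integral_rpow_mul_exp_neg_mul_rpow two_pos
    (by linarith [Nat.cast_nonneg (α := ℝ) (n - 1 + j)]) hκ]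
  have h1 : ((n - 1 + j : ℕ) : ℝ) + 1 = n + j := by
    have : n - 1 + j + 1 = n + j := by omega
    exact_mod_cast this
  rw [h1, finrank_euclideanSpace_fin, gaussMoment, sphereArea, neg_div]
  simp only [smul_eq_mul, nsmul_eq_mul]
  ring

theorem gaussMoment_zero_pos (hn : 1 ≤ n) : 0 < gaussMoment n 0 := by
  have h1 : 0 < sphereArea n := by
    have : 0 < volume.real (Metric.ball (0 : Euc n) 1) :=
      ENNReal.toReal_pos (Metric.measure_ball_pos _ _ one_pos).ne' measure_ball_lt_top.ne
    have : (0 : ℝ) < n := by exact_mod_cast hn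
    unfold sphereArea; positivity
  have h2 : 0 < Real.Gamma (((n : ℝ) + (0 : ℕ)) / 2) := Real.Gamma_pos_of_pos (by
    have : (0 : ℝ) < n := by exact_mod_cast hn
    simp; linarith)
  unfold gaussMoment; positivity

/-- The recurrence of Γ. It is what makes κ|w|² - n/2 have mean zero against e^{-κ|w|²}. -/
theorem gaussMoment_two (hn : 1 ≤ n) : gaussMoment n 2 = n / 2 * gaussMoment n 0 := by
  have hn' : (0 : ℝ) < n := by exact_mod_cast hn
  have := Real.Gamma_add_one (s := (n : ℝ) / 2) (by positivity)
  simp only [gaussMoment]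
  rw [show ((n : ℝ) + (2 : ℕ)) / 2 = n / 2 + 1 by push_cast; ring, this]
  simp only [Nat.cast_zero, add_zero]
  ring

theorem gaussMoment_nonneg (j : ℕ) : 0 ≤ gaussMoment n j := by
  have h2 : 0 ≤ Real.Gamma (((n : ℝ) + j) / 2) := Real.Gamma_nonneg_of_nonneg (by positivity)
  have := sphereArea_nonneg n
  unfold gaussMoment; positivity

theorem integral_odd {F : Euc n → ℝ} (hF : ∀ y, F (-y) = -F y) : ∫ y, F y = 0 := by
  have h := integral_neg_eq_self F volume
  simp only [hF, integral_neg] at h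
  linarith

/-- Completing the square: the product of the two Gaussians is centred at ν/(l+ν) · w. In the
centred variable v the last term is odd and integrates to zero. -/
theorem inner_mul_gauss_completeSquare {l ν : ℝ} (hl : 0 < l) (hν : 0 < ν) (v w : Euc n) :
    inner ℝ (v + (ν / (l + ν)) • w) (w - (v + (ν / (l + ν)) • w)) *
      (Real.exp (-l * ‖v + (ν / (l + ν)) • w‖ ^ 2) *
        Real.exp (-ν * ‖w - (v + (ν / (l + ν)) • w)‖ ^ 2)) =
    Real.exp (-(l * ν / (l + ν)) * ‖w‖ ^ 2) *
      (l * ν / (l + ν) ^ 2 * ‖w‖ ^ 2 * (‖v‖ ^ 0 * Real.exp (-(l + ν) * ‖v‖ ^ 2)) -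
        ‖v‖ ^ 2 * Real.exp (-(l + ν) * ‖v‖ ^ 2) +
        (l - ν) / (l + ν) * (inner ℝ v w * Real.exp (-(l + ν) * ‖v‖ ^ 2))) := by
  have hs : l + ν ≠ 0 := by positivity
  set a := ν / (l + ν) with ha
  have hw : w - (v + a • w) = (1 - a) • w - v := by module
  have h1 : ‖v + a • w‖ ^ 2 = ‖v‖ ^ 2 + 2 * a * inner ℝ v w + a ^ 2 * ‖w‖ ^ 2 := by
    rw [norm_add_sq_real, inner_smul_right, norm_smul, mul_pow, Real.norm_eq_abs, sq_abs]; ring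
  have h2 : ‖(1 - a) • w - v‖ ^ 2 =
      ‖v‖ ^ 2 - 2 * (1 - a) * inner ℝ v w + (1 - a) ^ 2 * ‖w‖ ^ 2 := by
    rw [norm_sub_sq_real, inner_smul_left, norm_smul, mul_pow, Real.norm_eq_abs, sq_abs,
      real_inner_comm]
    simp only [conj_trivial]; ring
  have h3 : inner ℝ (v + a • w) ((1 - a) • w - v) =
      a * (1 - a) * ‖w‖ ^ 2 - ‖v‖ ^ 2 + (1 - 2 * a) * inner ℝ v w := by
    rw [inner_sub_right, inner_add_left, inner_add_left, inner_smul_left, inner_smul_left,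
      inner_smul_right, inner_smul_right, real_inner_self_eq_norm_sq, real_inner_self_eq_norm_sq,
      real_inner_comm v w]
    simp only [conj_trivial]; ring
  have h4 : Real.exp (-l * ‖v + a • w‖ ^ 2) * Real.exp (-ν * ‖(1 - a) • w - v‖ ^ 2) =
      Real.exp (-(l * ν / (l + ν)) * ‖w‖ ^ 2) * Real.exp (-(l + ν) * ‖v‖ ^ 2) := by
    rw [← Real.exp_add, ← Real.exp_add, h1, h2, ha]
    congr 1
    field_simp
    ring
  rw [hw, h3, h4]
  have e1 : a * (1 - a) = l * ν / (l + ν) ^ 2 := by rw [ha]; field_simp; ring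
  have e2 : 1 - 2 * a = (l - ν) / (l + ν) := by rw [ha]; field_simp; ring
  rw [e1, e2]
  ring

theorem integrable_inner_mul_gauss (hn : 1 ≤ n) {s : ℝ} (hs : 0 < s) {M : ℝ} {ψ : Euc n → Euc n}
    (hψ : Measurable ψ) (hM : ∀ v, ‖ψ v‖ ≤ M) :
    Integrable fun v : Euc n => inner ℝ v (ψ v) * Real.exp (-s * ‖v‖ ^ 2) := by
  refine ((integrable_norm_pow_mul_gauss hn 1 hs).const_mul M).mono'
    (Measurable.aestronglyMeasurable (by fun_prop)) (Eventually.of_forall fun v => ?_)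
  rw [norm_mul, Real.norm_of_nonneg (Real.exp_nonneg _), pow_one]
  calc _ ≤ ‖v‖ * ‖ψ v‖ * Real.exp (-s * ‖v‖ ^ 2) := by gcongr; exact norm_inner_le_norm _ _
    _ ≤ ‖v‖ * M * Real.exp (-s * ‖v‖ ^ 2) := by gcongr; exact hM v
    _ = _ := by ring

/-- The `div`-convolution of the fields `y e^{-l|y|²}` and `y e^{-ν|y|²}`. -/
theorem integral_inner_mul_gauss_mul_gauss (hn : 1 ≤ n) {l ν : ℝ} (hl : 0 < l) (hν : 0 < ν)
    (w : Euc n) :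
    ∫ y : Euc n, inner ℝ y (w - y) *
        (Real.exp (-l * ‖y‖ ^ 2) * Real.exp (-ν * ‖w - y‖ ^ 2)) =
      gaussMoment n 0 * (l + ν) ^ (-((n : ℝ) / 2) - 1) *
        (Real.exp (-(l * ν / (l + ν)) * ‖w‖ ^ 2) * (l * ν / (l + ν) * ‖w‖ ^ 2 - n / 2)) := by
  have hs : 0 < l + ν := by positivity
  rw [← integral_add_right_eq_self _ ((ν / (l + ν)) • w)]
  simp only [inner_mul_gauss_completeSquare hl hν]
  have i0 := (integrable_norm_pow_mul_gauss hn 0 hs).const_mul (l * ν / (l + ν) ^ 2 * ‖w‖ ^ 2)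
  have i2 := integrable_norm_pow_mul_gauss hn 2 hs
  have i1 := (integrable_inner_mul_gauss hn hs (ψ := fun _ => w) measurable_const
    (fun _ => le_rfl)).const_mul ((l - ν) / (l + ν))
  have hodd : ∫ v : Euc n, inner ℝ v w * Real.exp (-(l + ν) * ‖v‖ ^ 2) = 0 :=
    integral_odd fun v => by simp
  have i02 : Integrable fun v : Euc n =>
      l * ν / (l + ν) ^ 2 * ‖w‖ ^ 2 * (‖v‖ ^ 0 * Real.exp (-(l + ν) * ‖v‖ ^ 2)) -
        ‖v‖ ^ 2 * Real.exp (-(l + ν) * ‖v‖ ^ 2) := i0.sub i2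
  rw [integral_const_mul, integral_add i02 i1, integral_sub i0 i2, integral_const_mul,
    integral_const_mul, hodd, integral_norm_pow_mul_gauss hn 0 hs,
    integral_norm_pow_mul_gauss hn 2 hs, gaussMoment_two hn]
  have e1 : (l + ν) ^ (-(((n : ℝ) + (0 : ℕ)) / 2)) = (l + ν) ^ (-((n : ℝ) / 2) - 1) * (l + ν) := by
    rw [← Real.rpow_add_one hs.ne']; congr 1; push_cast; ring
  have e2 : (l + ν) ^ (-(((n : ℝ) + (2 : ℕ)) / 2)) = (l + ν) ^ (-((n : ℝ) / 2) - 1) := by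
    congr 1; push_cast; ring
  rw [e1, e2]
  field_simp
  ring

/-! ### The Gaussian means of a function -/

/-- The function `κ ↦ ∫ e^{-κ|w|²} (κ|w|² - n/2) u(x-w) dw`. -/
def gaussDefect (u : Euc n → ℝ) (x : Euc n) (κ : ℝ) : ℝ :=
  ∫ w, Real.exp (-κ * ‖w‖ ^ 2) * (κ * ‖w‖ ^ 2 - n / 2) * u (x - w)

variable {u : Euc n → ℝ} {K : ℝ≥0}

theorem abs_gauss_mul_le {κ : ℝ} (hκ : 0 ≤ κ) (w : Euc n) :
    |Real.exp (-κ * ‖w‖ ^ 2) * (κ * ‖w‖ ^ 2 - n / 2)| ≤ 1 + (n : ℝ) / 2 := by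
  have ht : 0 ≤ κ * ‖w‖ ^ 2 := by positivity
  set t := κ * ‖w‖ ^ 2
  rw [neg_mul]
  change |Real.exp (-t) * (t - n / 2)| ≤ 1 + (n : ℝ) / 2
  rw [abs_mul, abs_of_nonneg (Real.exp_nonneg _)]
  have h1 : |t - (n : ℝ) / 2| ≤ t + n / 2 := by
    rw [abs_le]; constructor <;> linarith [(by positivity : (0 : ℝ) ≤ n / 2)]
  have h2 : Real.exp (-t) * t ≤ 1 := by
    rw [Real.exp_neg, inv_mul_le_iff₀ (Real.exp_pos _), mul_one]
    linarith [Real.add_one_le_exp t]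
  have h3 : Real.exp (-t) ≤ 1 := Real.exp_le_one_iff.2 (by linarith)
  calc _ ≤ Real.exp (-t) * (t + n / 2) := by gcongr
    _ = Real.exp (-t) * t + Real.exp (-t) * (n / 2) := by ring
    _ ≤ 1 + 1 * (n / 2) := by gcongr
    _ = _ := by ring

/-- Controls κ near 0. -/
theorem abs_gaussDefect_le (hi : Integrable u) (x : Euc n) {κ : ℝ} (hκ : 0 ≤ κ) :
    |gaussDefect u x κ| ≤ (1 + n / 2) * ∫ w, ‖u w‖ := by
  have h : ∫ w, (1 + (n : ℝ) / 2) * ‖u (x - w)‖ = (1 + n / 2) * ∫ w, ‖u w‖ := by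
    rw [integral_const_mul, integral_sub_left_eq_self (fun w => ‖u w‖) volume x]
  rw [← h, ← Real.norm_eq_abs]
  refine norm_integral_le_of_norm_le ((hi.comp_sub_left x).norm.const_mul _)
    (Eventually.of_forall fun w => ?_)
  rw [norm_mul, Real.norm_eq_abs]
  gcongr
  exact abs_gauss_mul_le hκ w

theorem abs_sub_translate_le (hu : LipschitzWith K u) (x w : Euc n) :
    |u (x - w) - u x| ≤ K * ‖w‖ := by
  have := hu.dist_le_mul (x - w) x
  rwa [Real.dist_eq, dist_eq_norm, sub_sub_cancel_left, norm_neg] at this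

theorem integrable_gauss_mul_translate (hi : Integrable u) (x : Euc n) {κ : ℝ} (hκ : 0 ≤ κ) :
    Integrable fun w => Real.exp (-κ * ‖w‖ ^ 2) * u (x - w) := by
  refine (hi.comp_sub_left x).bdd_mul (c := 1) (Measurable.aestronglyMeasurable (by fun_prop))
    (Eventually.of_forall fun w => ?_)
  rw [Real.norm_of_nonneg (Real.exp_nonneg _)]
  exact Real.exp_le_one_iff.2 (by nlinarith [sq_nonneg ‖w‖])

/-- Controls large κ. The weight has mean zero, so u(x - w) may be replaced by u(x - w) - u(x), and
the Lipschitz bound gains κ^{-1/2} over the Gaussian mass κ^{-n/2}. -/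
theorem abs_gaussDefect_le_rpow (hn : 1 ≤ n) (hi : Integrable u) (hu : LipschitzWith K u)
    (x : Euc n) {κ : ℝ} (hκ : 0 < κ) :
    |gaussDefect u x κ| ≤
      K * (gaussMoment n 3 + n / 2 * gaussMoment n 1) * κ ^ (-(((n : ℝ) + 1) / 2)) := by
  have i0 := integrable_norm_pow_mul_gauss hn 0 hκ
  have i1 := integrable_norm_pow_mul_gauss hn 1 hκ
  have i2 := integrable_norm_pow_mul_gauss hn 2 hκ
  have i3 := integrable_norm_pow_mul_gauss hn 3 hκ
  have hz : ∫ w : Euc n, Real.exp (-κ * ‖w‖ ^ 2) * (κ * ‖w‖ ^ 2 - n / 2) * u x = 0 := by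
    rw [integral_mul_const]
    have : ∫ w : Euc n, Real.exp (-κ * ‖w‖ ^ 2) * (κ * ‖w‖ ^ 2 - n / 2) =
        ∫ w : Euc n, (κ * (‖w‖ ^ 2 * Real.exp (-κ * ‖w‖ ^ 2)) -
          n / 2 * (‖w‖ ^ 0 * Real.exp (-κ * ‖w‖ ^ 2))) := by
      congr 1; ext w; ring
    rw [this, integral_sub (i2.const_mul _) (i0.const_mul _), integral_const_mul,
      integral_const_mul, integral_norm_pow_mul_gauss hn 0 hκ,
      integral_norm_pow_mul_gauss hn 2 hκ, gaussMoment_two hn]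
    have e : κ ^ (-(((n : ℝ) + (0 : ℕ)) / 2)) = κ ^ (-(((n : ℝ) + (2 : ℕ)) / 2)) * κ := by
      rw [← Real.rpow_add_one hκ.ne']; congr 1; push_cast; ring
    rw [e]; ring
  have hi0 : Integrable fun w : Euc n =>
      Real.exp (-κ * ‖w‖ ^ 2) * (κ * ‖w‖ ^ 2 - n / 2) * u x := by
    refine Integrable.mul_const ?_ _
    refine ((i2.const_mul κ).sub (i0.const_mul (n / 2))).congr (Eventually.of_forall fun w => ?_)
    simp only [Pi.sub_apply]; ring
  have hi1 : Integrable fun w : Euc n =>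
      Real.exp (-κ * ‖w‖ ^ 2) * (κ * ‖w‖ ^ 2 - n / 2) * u (x - w) :=
    (hi.comp_sub_left x).bdd_mul (Measurable.aestronglyMeasurable (by fun_prop))
      (Eventually.of_forall fun w => abs_gauss_mul_le hκ.le w)
  have e : gaussDefect u x κ = ∫ w : Euc n,
      Real.exp (-κ * ‖w‖ ^ 2) * (κ * ‖w‖ ^ 2 - n / 2) * (u (x - w) - u x) := by
    simp only [mul_sub _ (u _) (u x)]
    rw [integral_sub hi1 hi0, hz, sub_zero, gaussDefect]
  have hb : ∫ w : Euc n, K * (κ * (‖w‖ ^ 3 * Real.exp (-κ * ‖w‖ ^ 2)) +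
      n / 2 * (‖w‖ ^ 1 * Real.exp (-κ * ‖w‖ ^ 2))) =
      K * (gaussMoment n 3 + n / 2 * gaussMoment n 1) * κ ^ (-(((n : ℝ) + 1) / 2)) := by
    rw [integral_const_mul, integral_add (i3.const_mul _) (i1.const_mul _), integral_const_mul,
      integral_const_mul, integral_norm_pow_mul_gauss hn 3 hκ, integral_norm_pow_mul_gauss hn 1 hκ]
    have e : κ ^ (-(((n : ℝ) + 1) / 2)) = κ ^ (-(((n : ℝ) + (3 : ℕ)) / 2)) * κ := by
      rw [← Real.rpow_add_one hκ.ne']; congr 1; push_cast; ring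
    rw [Nat.cast_one, e]; ring
  rw [e, ← hb, ← Real.norm_eq_abs]
  refine norm_integral_le_of_norm_le (((i3.const_mul _).add (i1.const_mul _)).const_mul _)
    (Eventually.of_forall fun w => ?_)
  have h1 : |κ * ‖w‖ ^ 2 - (n : ℝ) / 2| ≤ κ * ‖w‖ ^ 2 + n / 2 := by
    have : 0 ≤ κ * ‖w‖ ^ 2 := by positivity
    rw [abs_le]; constructor <;> linarith [(by positivity : (0 : ℝ) ≤ n / 2)]
  rw [norm_mul, norm_mul, Real.norm_of_nonneg (Real.exp_nonneg _), Real.norm_eq_abs,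
    Real.norm_eq_abs]
  calc _ ≤ Real.exp (-κ * ‖w‖ ^ 2) * (κ * ‖w‖ ^ 2 + n / 2) * (K * ‖w‖) := by
        gcongr
        exact abs_sub_translate_le hu x w
    _ = _ := by ring

theorem measurable_gaussDefect (hu : Measurable u) (x : Euc n) : Measurable (gaussDefect u x) := by
  have h : Measurable (Function.uncurry fun (κ : ℝ) (w : Euc n) =>
      Real.exp (-κ * ‖w‖ ^ 2) * (κ * ‖w‖ ^ 2 - n / 2) * u (x - w)) := by
    unfold Function.uncurry; fun_prop
  exact h.stronglyMeasurable.integral_prod_right.measurable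

/-- Dominated by κ^{n/2-1} on (0, 1] and by κ^{-3/2} beyond 1. -/
theorem integrableOn_rpow_mul_gaussDefect (hn : 1 ≤ n) (hi : Integrable u)
    (hu : LipschitzWith K u) (x : Euc n) :
    IntegrableOn (fun κ => κ ^ ((n : ℝ) / 2 - 1) * gaussDefect u x κ) (Set.Ioi 0) := by
  have hn' : (0 : ℝ) < n := by exact_mod_cast hn
  have hm : Measurable fun κ => κ ^ ((n : ℝ) / 2 - 1) * gaussDefect u x κ := by
    have := measurable_gaussDefect hu.continuous.measurable x
    fun_prop
  rw [← Set.Ioc_union_Ioi_eq_Ioi zero_le_one, integrableOn_union]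
  constructor
  · have h : IntegrableOn (fun κ : ℝ => κ ^ ((n : ℝ) / 2 - 1) * ((1 + n / 2) * ∫ w, ‖u w‖))
        (Set.Ioc 0 1) := by
      refine Integrable.mul_const ?_ _
      rw [← IntegrableOn, integrableOn_Ioc_iff_integrableOn_Ioo,
        intervalIntegral.integrableOn_Ioo_rpow_iff one_pos]
      linarith
    refine h.mono' hm.aestronglyMeasurable ?_
    filter_upwards [ae_restrict_mem measurableSet_Ioc] with κ hκ
    have hκ0 : 0 < κ := hκ.1
    rw [norm_mul, Real.norm_of_nonneg (by positivity)]
    gcongr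
    exact abs_gaussDefect_le hi x hκ0.le
  · have h : IntegrableOn (fun κ : ℝ => K * (gaussMoment n 3 + n / 2 * gaussMoment n 1) *
        κ ^ (-(3 / 2) : ℝ)) (Set.Ioi 1) :=
      (integrableOn_Ioi_rpow_of_lt (by norm_num) one_pos).const_mul _
    refine h.mono' hm.aestronglyMeasurable ?_
    filter_upwards [ae_restrict_mem measurableSet_Ioi] with κ hκ
    have hκ0 : 0 < κ := one_pos.trans hκ
    rw [norm_mul, Real.norm_of_nonneg (by positivity)]
    have e : κ ^ (-(3 / 2) : ℝ) = κ ^ ((n : ℝ) / 2 - 1) * κ ^ (-(((n : ℝ) + 1) / 2)) := by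
      rw [← Real.rpow_add hκ0]; congr 1; ring
    rw [e, mul_left_comm]
    gcongr
    exact abs_gaussDefect_le_rpow hn hi hu x hκ0

theorem hasDerivAt_gaussMean (hi : Integrable u) (hu : Continuous u) (hc : HasCompactSupport u)
    (x : Euc n) {κ : ℝ} (hκ : 0 < κ) :
    HasDerivAt (fun κ => ∫ w, Real.exp (-κ * ‖w‖ ^ 2) * u (x - w))
      (∫ w, -‖w‖ ^ 2 * Real.exp (-κ * ‖w‖ ^ 2) * u (x - w)) κ := by
  have hci : Integrable fun w => ‖w‖ ^ 2 * u (x - w) := by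
    refine Continuous.integrable_of_hasCompactSupport (by fun_prop) ?_
    exact HasCompactSupport.mul_left (hc.comp_homeomorph (Homeomorph.subLeft x))
  refine (hasDerivAt_integral_of_dominated_loc_of_deriv_le (Ioi_mem_nhds hκ)
    (F := fun κ w => Real.exp (-κ * ‖w‖ ^ 2) * u (x - w))
    (F' := fun κ w => -‖w‖ ^ 2 * Real.exp (-κ * ‖w‖ ^ 2) * u (x - w))
    (Eventually.of_forall fun κ' => ?_) (integrable_gauss_mul_translate hi x hκ.le) ?_
    (bound := fun w => ‖‖w‖ ^ 2 * u (x - w)‖)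
    (Eventually.of_forall fun w κ' hκ' => ?_) hci.norm
    (Eventually.of_forall fun w κ' hκ' => ?_)).2
  · exact Continuous.aestronglyMeasurable (by fun_prop)
  · exact Continuous.aestronglyMeasurable (by fun_prop)
  · have : Real.exp (-κ' * ‖w‖ ^ 2) ≤ 1 := Real.exp_le_one_iff.2 (by
      have : 0 < κ' := hκ'
      nlinarith [sq_nonneg ‖w‖])
    rw [norm_mul, norm_mul, norm_mul, norm_neg, Real.norm_of_nonneg (Real.exp_nonneg _)]
    calc _ ≤ ‖‖w‖ ^ 2‖ * 1 * ‖u (x - w)‖ := by gcongr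
      _ = _ := by ring
  · have h := (((hasDerivAt_id κ').neg.mul_const (‖w‖ ^ 2)).exp).mul_const (u (x - w))
    refine h.congr_deriv ?_
    change Real.exp (-κ' * ‖w‖ ^ 2) * (-1 * ‖w‖ ^ 2) * u (x - w) = _
    ring

/-- Reconstruction of `u` from its Gaussian means. -/
theorem integral_rpow_mul_gaussDefect (hn : 1 ≤ n) (hc : HasCompactSupport u)
    (hu : LipschitzWith K u) (x : Euc n) :
    ∫ κ in Set.Ioi (0 : ℝ), κ ^ ((n : ℝ) / 2 - 1) * gaussDefect u x κ =
      -(gaussMoment n 0 * u x) := by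
  have hn' : (0 : ℝ) < n := by exact_mod_cast hn
  have hi : Integrable u := hu.continuous.integrable_of_hasCompactSupport hc
  set G : ℝ → ℝ := fun κ => ∫ w, Real.exp (-κ * ‖w‖ ^ 2) * u (x - w) with hG
  -- An explicit antiderivative of the integrand. It vanishes at κ = 0, and at infinity κ^{n/2}
  -- e^{-κ|w|²} is an approximate identity of mass `gaussMoment n 0`.
  set F : ℝ → ℝ := fun κ => -(κ ^ ((n : ℝ) / 2) * G κ) with hF
  have hGb : ∀ κ, 0 ≤ κ → |G κ| ≤ ∫ w, ‖u w‖ := fun κ hκ => by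
    rw [← integral_sub_left_eq_self (fun w => ‖u w‖) volume x, ← Real.norm_eq_abs]
    refine norm_integral_le_of_norm_le (hi.comp_sub_left x).norm (Eventually.of_forall fun w => ?_)
    rw [norm_mul, Real.norm_of_nonneg (Real.exp_nonneg _)]
    exact mul_le_of_le_one_left (norm_nonneg _)
      (Real.exp_le_one_iff.2 (by nlinarith [sq_nonneg ‖w‖]))
  have hF0 : F 0 = 0 := by simp [hF, Real.zero_rpow (by positivity : (n : ℝ) / 2 ≠ 0)]
  have hcont : ContinuousWithinAt F (Set.Ici 0) 0 := by
    rw [ContinuousWithinAt, hF0]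
    refine squeeze_zero_norm' (a := fun κ : ℝ => κ ^ ((n : ℝ) / 2) * ∫ w, ‖u w‖) ?_ ?_
    · filter_upwards [self_mem_nhdsWithin] with κ hκ
      have hκ' : 0 ≤ κ := hκ
      rw [hF, norm_neg, norm_mul, Real.norm_of_nonneg (by positivity)]
      gcongr
      exact hGb κ hκ'
    · have h : Tendsto (fun κ : ℝ => κ ^ ((n : ℝ) / 2) * ∫ w, ‖u w‖) (𝓝 0)
          (𝓝 (0 ^ ((n : ℝ) / 2) * ∫ w, ‖u w‖)) :=
        ((Real.continuousAt_rpow_const 0 _ (Or.inr (by positivity))).tendsto).mul_const _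
      rw [Real.zero_rpow (by positivity), zero_mul] at h
      exact h.mono_left nhdsWithin_le_nhds
  have hderiv : ∀ κ ∈ Set.Ioi (0 : ℝ),
      HasDerivAt F (κ ^ ((n : ℝ) / 2 - 1) * gaussDefect u x κ) κ := by
    intro κ hκ
    have hκ0 : 0 < κ := hκ
    have h := ((Real.hasDerivAt_rpow_const (p := (n : ℝ) / 2) (Or.inl hκ0.ne')).mul
      (hasDerivAt_gaussMean hi hu.continuous hc x hκ0)).neg
    refine h.congr_deriv ?_
    have hi1 := integrable_gauss_mul_translate hi x hκ0.le
    have hi2 : Integrable fun w => -‖w‖ ^ 2 * Real.exp (-κ * ‖w‖ ^ 2) * u (x - w) := by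
      have := hu.continuous
      refine Continuous.integrable_of_hasCompactSupport (by fun_prop) ?_
      exact HasCompactSupport.mul_left (hc.comp_homeomorph (Homeomorph.subLeft x))
    have e : gaussDefect u x κ =
        -κ * (∫ w, -‖w‖ ^ 2 * Real.exp (-κ * ‖w‖ ^ 2) * u (x - w)) - n / 2 * G κ := by
      rw [hG, gaussDefect, ← integral_const_mul, ← integral_const_mul,
        ← integral_sub (hi2.const_mul _) (hi1.const_mul _)]
      congr 1; ext w; ring
    have e2 : κ ^ ((n : ℝ) / 2) = κ ^ ((n : ℝ) / 2 - 1) * κ := by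
      rw [← Real.rpow_add_one hκ0.ne']; congr 1; ring
    rw [e, e2]; ring
  have hlim : Tendsto F atTop (𝓝 (-(gaussMoment n 0 * u x))) := by
    refine Tendsto.neg ?_
    rw [tendsto_iff_norm_sub_tendsto_zero]
    have hz : Tendsto (fun κ : ℝ => K * gaussMoment n 1 * κ ^ (-(1 / 2) : ℝ)) atTop (𝓝 0) := by
      simpa using (tendsto_rpow_neg_atTop (y := 1 / 2) (by norm_num)).const_mul
        (K * gaussMoment n 1)
    refine squeeze_zero' (Eventually.of_forall fun _ => norm_nonneg _) ?_ hz
    filter_upwards [Ioi_mem_atTop (0 : ℝ)] with κ hκ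
    have hκ0 : 0 < κ := hκ
    have i0 := integrable_norm_pow_mul_gauss hn 0 hκ0
    have i1 := integrable_norm_pow_mul_gauss hn 1 hκ0
    have hi1 := integrable_gauss_mul_translate hi x hκ0.le
    have h0 : κ ^ ((n : ℝ) / 2) *
        ∫ w : Euc n, ‖w‖ ^ 0 * Real.exp (-κ * ‖w‖ ^ 2) = gaussMoment n 0 := by
      rw [integral_norm_pow_mul_gauss hn 0 hκ0, mul_left_comm, ← Real.rpow_add hκ0]
      simp
    have e : κ ^ ((n : ℝ) / 2) * G κ - gaussMoment n 0 * u x =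
        κ ^ ((n : ℝ) / 2) * ∫ w : Euc n, Real.exp (-κ * ‖w‖ ^ 2) * (u (x - w) - u x) := by
      have e1 : ∫ w : Euc n, Real.exp (-κ * ‖w‖ ^ 2) * (u (x - w) - u x) =
          G κ - (∫ w : Euc n, ‖w‖ ^ 0 * Real.exp (-κ * ‖w‖ ^ 2)) * u x := by
        rw [hG, ← integral_mul_const, ← integral_sub hi1 (i0.mul_const _)]
        congr 1; ext w; ring
      rw [e1, ← h0]; ring
    rw [e, norm_mul, Real.norm_of_nonneg (by positivity)]
    have hb : ‖∫ w : Euc n, Real.exp (-κ * ‖w‖ ^ 2) * (u (x - w) - u x)‖ ≤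
        K * (gaussMoment n 1 * κ ^ (-(((n : ℝ) + (1 : ℕ)) / 2))) := by
      rw [← integral_norm_pow_mul_gauss hn 1 hκ0, ← integral_const_mul]
      refine norm_integral_le_of_norm_le (i1.const_mul _) (Eventually.of_forall fun w => ?_)
      rw [norm_mul, Real.norm_of_nonneg (Real.exp_nonneg _), Real.norm_eq_abs]
      calc _ ≤ Real.exp (-κ * ‖w‖ ^ 2) * (K * ‖w‖) := by
            gcongr
            exact abs_sub_translate_le hu x w
        _ = _ := by ring
    calc _ ≤ κ ^ ((n : ℝ) / 2) * (K * (gaussMoment n 1 * κ ^ (-(((n : ℝ) + (1 : ℕ)) / 2)))) := by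
          gcongr
      _ = _ := by
        have : κ ^ (-(1 / 2) : ℝ) = κ ^ ((n : ℝ) / 2) * κ ^ (-(((n : ℝ) + (1 : ℕ)) / 2)) := by
          rw [← Real.rpow_add hκ0]; congr 1; push_cast; ring
        rw [this]; ring
  rw [integral_Ioi_of_hasDerivAt_of_tendsto hcont hderiv
    (integrableOn_rpow_mul_gaussDefect hn hi hu x) hlim, hF0, sub_zero]

end Gaussian

/-! ### Inversion of the fractional divergence -/

section Inversion

variable {n : ℕ} {α : ℝ}

theorem integrableOn_rpow_mul_exp_neg_mul {s b : ℝ} (hs : 0 < s) (hb : 0 < b) :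
    IntegrableOn (fun t : ℝ => t ^ (s - 1) * Real.exp (-t * b)) (Set.Ioi 0) := by
  have h := integrableOn_rpow_mul_exp_neg_mul_rpow (s := s - 1) (p := 1) (by linarith) one_pos hb
  refine h.congr_fun (fun t _ => ?_) measurableSet_Ioi
  simp only [Real.rpow_one]
  ring_nf

/-- The Gamma integral writes a negative power of |z| as a superposition of Gaussians; it is used
for both singular kernels. -/
theorem integral_rpow_mul_exp_neg_mul_norm_sq {s : ℝ} (hs : 0 < s) {z : Euc n} (hz : z ≠ 0) :
    ∫ t in Set.Ioi (0 : ℝ), t ^ (s - 1) * Real.exp (-t * ‖z‖ ^ 2) =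
      Real.Gamma s * ‖z‖ ^ (-(2 * s)) := by
  have hz0 : 0 < ‖z‖ := norm_pos_iff.2 hz
  have h := Real.integral_rpow_mul_exp_neg_mul_Ioi hs (r := ‖z‖ ^ 2) (by positivity)
  have e : ∀ t : ℝ, -(‖z‖ ^ 2 * t) = -t * ‖z‖ ^ 2 := fun t => by ring
  simp only [e] at h
  rw [h, mul_comm, one_div, Real.inv_rpow (by positivity), ← Real.rpow_neg (by positivity),
    ← Real.rpow_natCast, ← Real.rpow_mul hz0.le]
  congr 2; push_cast; ring

theorem integrableOn_rpow_mul_add_rpow {a b l : ℝ} (ha : 0 < a) (hab : a < b) (hl : 0 < l) :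
    IntegrableOn (fun t : ℝ => t ^ (a - 1) * (l + t) ^ (-b)) (Set.Ioi 0) := by
  have hm : Measurable fun t : ℝ => t ^ (a - 1) * (l + t) ^ (-b) := by fun_prop
  rw [← Set.Ioc_union_Ioi_eq_Ioi zero_le_one, integrableOn_union]
  constructor
  · have h : IntegrableOn (fun t : ℝ => t ^ (a - 1) * l ^ (-b)) (Set.Ioc 0 1) := by
      refine Integrable.mul_const ?_ _
      rw [← IntegrableOn, integrableOn_Ioc_iff_integrableOn_Ioo,
        intervalIntegral.integrableOn_Ioo_rpow_iff one_pos]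
      linarith
    refine h.mono' hm.aestronglyMeasurable ?_
    filter_upwards [ae_restrict_mem measurableSet_Ioc] with t ht
    have ht0 : 0 < t := ht.1
    rw [Real.norm_of_nonneg (by positivity)]
    have := Real.rpow_le_rpow_of_nonpos hl (show l ≤ l + t by linarith) (show -b ≤ 0 by linarith)
    gcongr
  · have h : IntegrableOn (fun t : ℝ => t ^ (a - 1 + -b)) (Set.Ioi 1) :=
      integrableOn_Ioi_rpow_of_lt (by linarith) one_pos
    refine h.mono' hm.aestronglyMeasurable ?_
    filter_upwards [ae_restrict_mem measurableSet_Ioi] with t ht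
    have ht0 : 0 < t := one_pos.trans ht
    rw [Real.norm_of_nonneg (by positivity), Real.rpow_add ht0]
    have := Real.rpow_le_rpow_of_nonpos ht0 (show t ≤ l + t by linarith) (show -b ≤ 0 by linarith)
    gcongr

/-- The sup bound is used in the unit ball, |z|^{α-n} ≤ 1 outside. The estimate sees only S and the
L¹ norm, hence is uniform over translates of a. -/
theorem integrable_rpow_mul_of_bounded (hn : 1 ≤ n) (hα0 : 0 < α) (hα1 : α < 1)
    {a : Euc n → ℝ} (ha : Integrable a) {S : ℝ} (hS : ∀ z, ‖a z‖ ≤ S) :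
    Integrable (fun z => ‖z‖ ^ (α - n) * a z) ∧
      ∫ z, ‖‖z‖ ^ (α - n) * a z‖ ≤ S * (sphereArea n * (1 / α)) + ∫ z, ‖a z‖ := by
  have hn' : (1 : ℝ) ≤ n := by exact_mod_cast hn
  set p : Euc n → ℝ := (Metric.ball 0 1).indicator fun z => ‖z‖ ^ (α - n) with hp
  have hpi : Integrable p := (integrable_indicator_iff measurableSet_ball).2
    ((integrableOn_ball_norm_rpow_iff hn one_pos).2 (by simpa using hα0))
  have hb : ∀ z, ‖‖z‖ ^ (α - n) * a z‖ ≤ S * p z + ‖a z‖ := fun z => by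
    rw [norm_mul, Real.norm_of_nonneg (by positivity)]
    by_cases hz : ‖z‖ < 1
    · rw [hp, Set.indicator_of_mem (mem_ball_zero_iff.2 hz), mul_comm S]
      have : ‖z‖ ^ (α - n) * ‖a z‖ ≤ ‖z‖ ^ (α - n) * S := by gcongr; exact hS z
      linarith [norm_nonneg (a z)]
    · rw [hp, Set.indicator_of_notMem (mt mem_ball_zero_iff.1 hz), mul_zero, zero_add]
      exact mul_le_of_le_one_left (norm_nonneg _)
        (Real.rpow_le_one_of_one_le_of_nonpos (not_lt.1 hz) (by linarith))
  have hbi : Integrable fun z => S * p z + ‖a z‖ := (hpi.const_mul S).add ha.norm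
  refine ⟨hbi.mono' ((Measurable.aestronglyMeasurable (by fun_prop)).mul ha.aestronglyMeasurable)
    (Eventually.of_forall hb), ?_⟩
  refine (integral_mono_of_nonneg (Eventually.of_forall fun _ => norm_nonneg _) hbi
    (Eventually.of_forall hb)).trans_eq ?_
  rw [integral_add (hpi.const_mul S) ha.norm, integral_const_mul, hp,
    integral_indicator measurableSet_ball, integral_ball_norm_rpow hn hα0 zero_le_one,
    Real.one_rpow]

/-- The field `K * u`, where `K` is the Riesz-type kernel. -/
def rieszConv (α : ℝ) (u : Euc n → ℝ) (x : Euc n) : Euc n := ∫ z, u (x - z) • rieszKer α z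

theorem integrable_smul_rieszKer (hn : 1 ≤ n) (hα0 : 0 < α) (hα1 : α < 1) {a : Euc n → ℝ}
    (ha : Integrable a) {S : ℝ} (hS : ∀ z, ‖a z‖ ≤ S) :
    Integrable (fun z => a z • rieszKer α z) := by
  refine (integrable_rpow_mul_of_bounded hn hα0 hα1 ha hS).1.norm.mono'
    (ha.aestronglyMeasurable.smul measurable_rieszKer.aestronglyMeasurable)
    (Eventually.of_forall fun z => ?_)
  rw [norm_smul, norm_rieszKer hn hα1, norm_mul, Real.norm_of_nonneg (by positivity : 0 ≤ ‖z‖ ^ (α - (n : ℝ))),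
    mul_comm]

/-- Subordination of the kernel of the fractional divergence to Gaussians. -/
theorem pvDiv_eq_integral_gauss (hn : 1 ≤ n) (hα0 : 0 < α) (hα1 : α < 1) {φ : Euc n → Euc n}
    {M Λ : ℝ} (hφ : IsBddLip φ M Λ) (x : Euc n) :
    pvDiv α φ x = (Real.Gamma (((n : ℝ) + α + 1) / 2))⁻¹ *
      ∫ l in Set.Ioi (0 : ℝ), l ^ (((n : ℝ) + α + 1) / 2 - 1) *
        ∫ y, inner ℝ y (φ (x + y)) * Real.exp (-l * ‖y‖ ^ 2) := by
  set A := ((n : ℝ) + α + 1) / 2 with hA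
  have hA0 : 0 < A := by positivity
  have hΓ : 0 < Real.Gamma A := Real.Gamma_pos_of_pos hA0
  have hφm := hφ.continuous.measurable
  set ν : Measure ℝ := volume.restrict (Set.Ioi 0) with hν
  -- φ(x) is subtracted before Fubini, since the unsubtracted integrand need not be absolutely
  -- integrable at y = 0; for fixed l it drops out again by oddness.
  set F : Euc n → ℝ → ℝ := fun y l =>
    inner ℝ y (φ (x + y) - φ x) * (l ^ (A - 1) * Real.exp (-l * ‖y‖ ^ 2)) with hF
  have hFm : Measurable (Function.uncurry F) := by
    simp only [hF]; unfold Function.uncurry; fun_prop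
  have hFi : ∀ y, Integrable (F y) ν := fun y => by
    rcases eq_or_ne y 0 with rfl | hy
    · simp [hF]
    · exact (integrableOn_rpow_mul_exp_neg_mul hA0
        (by have := norm_pos_iff.2 hy; positivity)).const_mul _
  have hker : ∀ y v : Euc n, inner ℝ y v * ∫ l, l ^ (A - 1) * Real.exp (-l * ‖y‖ ^ 2) ∂ν =
      Real.Gamma A * divKer α y v := fun y v => by
    rcases eq_or_ne y 0 with rfl | hy
    · simp [divKer]
    · rw [hν, integral_rpow_mul_exp_neg_mul_norm_sq hA0 hy, divKer, div_eq_mul_inv,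
        ← Real.rpow_neg (norm_nonneg _), hA]
      ring_nf
  have hFint : ∀ y, ∫ l, F y l ∂ν = Real.Gamma A * divKer α y (φ (x + y) - φ x) := fun y => by
    simp only [hF]; rw [integral_const_mul, hker]
  have hFnorm : ∀ y, ∫ l, ‖F y l‖ ∂ν = ‖Real.Gamma A * divKer α y (φ (x + y) - φ x)‖ := fun y => by
    rw [← hker, norm_mul, Real.norm_of_nonneg (setIntegral_nonneg measurableSet_Ioi
      fun l hl => mul_nonneg (Real.rpow_nonneg (le_of_lt hl) _) (Real.exp_nonneg _)),
      ← integral_const_mul]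
    refine setIntegral_congr_fun measurableSet_Ioi fun l hl => ?_
    simp only [hF]
    rw [norm_mul, Real.norm_of_nonneg (mul_nonneg (Real.rpow_nonneg (le_of_lt hl) _)
      (Real.exp_nonneg _))]
  have hFprod : Integrable (Function.uncurry F) (volume.prod ν) := by
    rw [integrable_prod_iff hFm.aestronglyMeasurable]
    refine ⟨Eventually.of_forall hFi, ?_⟩
    simp only [Function.uncurry_apply_pair, hFnorm]
    exact ((integrable_divKer_sub hn hα0 hα1 hφ x).const_mul _).norm
  have hswap := integral_integral_swap hFprod
  simp only [hFint, integral_const_mul] at hswap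
  rw [pvDiv, eq_inv_mul_iff_mul_eq₀ hΓ.ne', hswap]
  refine setIntegral_congr_fun measurableSet_Ioi fun l hl => ?_
  have hl0 : 0 < l := hl
  have i1 : Integrable fun y => inner ℝ y (φ (x + y)) * Real.exp (-l * ‖y‖ ^ 2) :=
    integrable_inner_mul_gauss hn hl0 (ψ := fun y => φ (x + y)) (by fun_prop)
      (fun y => hφ.norm_le _)
  have i2 : Integrable fun y => inner ℝ y (φ x) * Real.exp (-l * ‖y‖ ^ 2) :=
    integrable_inner_mul_gauss hn hl0 (ψ := fun y => φ x) (by fun_prop) (fun y => hφ.norm_le _)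
  have hodd : ∫ y, inner ℝ y (φ x) * Real.exp (-l * ‖y‖ ^ 2) = 0 :=
    integral_odd fun v => by simp
  have e : (fun y => F y l) = fun y => l ^ (A - 1) *
      (inner ℝ y (φ (x + y)) * Real.exp (-l * ‖y‖ ^ 2) -
        inner ℝ y (φ x) * Real.exp (-l * ‖y‖ ^ 2)) := by
    ext y; simp only [hF, inner_sub_right]; ring
  simp only [e]
  rw [integral_const_mul, integral_sub i1 i2, hodd, sub_zero]

theorem norm_mul_gauss_le {l : ℝ} (hl : 0 < l) (y : Euc n) :
    ‖y‖ * Real.exp (-l * ‖y‖ ^ 2) ≤ 1 + 1 / l := by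
  have h1 : Real.exp (-l * ‖y‖ ^ 2) ≤ 1 := Real.exp_le_one_iff.2 (by nlinarith [sq_nonneg ‖y‖])
  have h2 : l * ‖y‖ ^ 2 * Real.exp (-l * ‖y‖ ^ 2) ≤ 1 := by
    rw [neg_mul, Real.exp_neg, ← div_eq_mul_inv, div_le_one (Real.exp_pos _)]
    linarith [Real.add_one_le_exp (l * ‖y‖ ^ 2)]
  have h3 : ‖y‖ ^ 2 * Real.exp (-l * ‖y‖ ^ 2) ≤ 1 / l := by
    rw [le_div_iff₀ hl]; linarith
  have h4 : ‖y‖ ≤ 1 + ‖y‖ ^ 2 := by nlinarith [sq_nonneg (‖y‖ - 1), norm_nonneg y]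
  calc _ ≤ (1 + ‖y‖ ^ 2) * Real.exp (-l * ‖y‖ ^ 2) := by gcongr
    _ = Real.exp (-l * ‖y‖ ^ 2) + ‖y‖ ^ 2 * Real.exp (-l * ‖y‖ ^ 2) := by ring
    _ ≤ _ := by linarith

theorem integrable_norm_mul_gauss_mul_rpow (hn : 1 ≤ n) (hα0 : 0 < α) (hα1 : α < 1) {l : ℝ}
    (hl : 0 < l) (w : Euc n) :
    Integrable fun y : Euc n => ‖y‖ * Real.exp (-l * ‖y‖ ^ 2) * ‖w - y‖ ^ (α - n) := by
  have h0 : Integrable fun y : Euc n => ‖y‖ * Real.exp (-l * ‖y‖ ^ 2) := by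
    simpa using integrable_norm_pow_mul_gauss hn 1 hl
  have h := (integrable_rpow_mul_of_bounded hn hα0 hα1 (h0.comp_sub_left w) (S := 1 + 1 / l)
    (fun z => ?_)).1.comp_sub_left w
  · refine h.congr (Eventually.of_forall fun y => ?_)
    simp only [sub_sub_cancel]; ring
  · rw [Real.norm_of_nonneg (by positivity)]
    exact norm_mul_gauss_le hl _

/-- The Gaussian divergence of the Riesz-type kernel. -/
theorem integral_inner_rieszKer_mul_gauss (hn : 1 ≤ n) (hα0 : 0 < α) (hα1 : α < 1) {l : ℝ}
    (hl : 0 < l) (w : Euc n) :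
    ∫ y, inner ℝ y (rieszKer α (w - y)) * Real.exp (-l * ‖y‖ ^ 2) =
      (Real.Gamma (((n : ℝ) + 1 - α) / 2))⁻¹ *
        ∫ ν in Set.Ioi (0 : ℝ), ν ^ (((n : ℝ) + 1 - α) / 2 - 1) *
          (gaussMoment n 0 * (l + ν) ^ (-((n : ℝ) / 2) - 1) *
        (Real.exp (-(l * ν / (l + ν)) * ‖w‖ ^ 2) * (l * ν / (l + ν) * ‖w‖ ^ 2 - n / 2))) := by
  have hn' : (1 : ℝ) ≤ n := by exact_mod_cast hn
  set B := ((n : ℝ) + 1 - α) / 2 with hB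
  have hB0 : 0 < B := by rw [hB]; linarith
  have hΓ : 0 < Real.Gamma B := Real.Gamma_pos_of_pos hB0
  set ρ : Measure ℝ := volume.restrict (Set.Ioi 0) with hρ
  set F : Euc n → ℝ → ℝ := fun y ν =>
    (inner ℝ y (w - y) * Real.exp (-l * ‖y‖ ^ 2)) *
      (ν ^ (B - 1) * Real.exp (-ν * ‖w - y‖ ^ 2)) with hF
  have hFm : Measurable (Function.uncurry F) := by
    simp only [hF]; unfold Function.uncurry; fun_prop
  have hFi : ∀ y, Integrable (F y) ρ := fun y => by
    rcases eq_or_ne (w - y) 0 with hy | hy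
    · simp [hF, hy]
    · exact (integrableOn_rpow_mul_exp_neg_mul hB0
        (by have := norm_pos_iff.2 hy; positivity)).const_mul _
  have hker : ∀ y : Euc n, (inner ℝ y (w - y) * Real.exp (-l * ‖y‖ ^ 2)) *
      ∫ ν, ν ^ (B - 1) * Real.exp (-ν * ‖w - y‖ ^ 2) ∂ρ =
      Real.Gamma B * (inner ℝ y (rieszKer α (w - y)) * Real.exp (-l * ‖y‖ ^ 2)) := fun y => by
    rcases eq_or_ne (w - y) 0 with hy | hy
    · simp [rieszKer, hy]
    · rw [hρ, integral_rpow_mul_exp_neg_mul_norm_sq hB0 hy, rieszKer, inner_smul_right, hB]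
      ring_nf
  have hFint : ∀ y, ∫ ν, F y ν ∂ρ =
      Real.Gamma B * (inner ℝ y (rieszKer α (w - y)) * Real.exp (-l * ‖y‖ ^ 2)) := fun y => by
    simp only [hF]; rw [integral_const_mul, hker]
  have hFnorm : ∀ y, ∫ ν, ‖F y ν‖ ∂ρ =
      ‖Real.Gamma B * (inner ℝ y (rieszKer α (w - y)) * Real.exp (-l * ‖y‖ ^ 2))‖ := fun y => by
    rw [← hker, norm_mul, Real.norm_of_nonneg (setIntegral_nonneg measurableSet_Ioi
      fun ν hν => mul_nonneg (Real.rpow_nonneg (le_of_lt hν) _) (Real.exp_nonneg _)),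
      ← integral_const_mul]
    refine setIntegral_congr_fun measurableSet_Ioi fun ν hν => ?_
    simp only [hF]
    rw [norm_mul, Real.norm_of_nonneg (mul_nonneg (Real.rpow_nonneg (le_of_lt hν) _)
      (Real.exp_nonneg _))]
  have hKi : Integrable fun y =>
      inner ℝ y (rieszKer α (w - y)) * Real.exp (-l * ‖y‖ ^ 2) := by
    have := measurable_rieszKer (n := n) (α := α)
    refine (integrable_norm_mul_gauss_mul_rpow hn hα0 hα1 hl w).mono'
      (Measurable.aestronglyMeasurable (by fun_prop)) (Eventually.of_forall fun y => ?_)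
    rw [norm_mul, Real.norm_of_nonneg (Real.exp_nonneg _), ← norm_rieszKer hn hα1]
    calc _ ≤ ‖y‖ * ‖rieszKer α (w - y)‖ * Real.exp (-l * ‖y‖ ^ 2) := by
          gcongr; exact norm_inner_le_norm _ _
      _ = _ := by ring
  have hFprod : Integrable (Function.uncurry F) (volume.prod ρ) := by
    rw [integrable_prod_iff hFm.aestronglyMeasurable]
    refine ⟨Eventually.of_forall hFi, ?_⟩
    simp only [Function.uncurry_apply_pair, hFnorm]
    exact (hKi.const_mul _).norm
  have hswap := integral_integral_swap hFprod
  simp only [hFint, integral_const_mul] at hswap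
  rw [eq_inv_mul_iff_mul_eq₀ hΓ.ne', hswap]
  refine setIntegral_congr_fun measurableSet_Ioi fun ν hν => ?_
  have hν0 : 0 < ν := hν
  rw [← integral_inner_mul_gauss_mul_gauss hn hl hν0, ← integral_const_mul]
  congr 1; ext y
  simp only [hF]; ring

/-- Unfold the convolution and integrate in y first: the inner integral is the Gaussian divergence
of K at w. Integrating next in w collects `gaussDefect` at κ = lν/(l+ν). The minus sign comes from y
↦ -y. -/
theorem integral_inner_rieszConv_mul_gauss (hn : 1 ≤ n) (hα0 : 0 < α) (hα1 : α < 1)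
    {u : Euc n → ℝ} (hu : Continuous u) (hc : HasCompactSupport u) {l : ℝ} (hl : 0 < l)
    (x : Euc n) :
    ∫ y, inner ℝ y (rieszConv α u (x + y)) * Real.exp (-l * ‖y‖ ^ 2) =
      -((Real.Gamma (((n : ℝ) + 1 - α) / 2))⁻¹ * gaussMoment n 0 *
        ∫ ν in Set.Ioi (0 : ℝ), ν ^ (((n : ℝ) + 1 - α) / 2 - 1) *
          (l + ν) ^ (-((n : ℝ) / 2) - 1) * gaussDefect u x (l * ν / (l + ν))) := by
  have hn' : (1 : ℝ) ≤ n := by exact_mod_cast hn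
  obtain ⟨S, hS⟩ := hc.exists_bound_of_continuous hu
  have hui : Integrable u := hu.integrable_of_hasCompactSupport hc
  have hum := hu.measurable
  have hKm := measurable_rieszKer (n := n) (α := α)
  set B := ((n : ℝ) + 1 - α) / 2 with hB
  have hB0 : 0 < B := by rw [hB]; linarith
  set m := gaussMoment n 0 with hm
  set H : Euc n → Euc n → ℝ := fun y w =>
    u (x - w) * (inner ℝ y (rieszKer α (w - y)) * Real.exp (-l * ‖y‖ ^ 2)) with hH
  have hHm : Measurable (Function.uncurry H) := by
    simp only [hH]; unfold Function.uncurry; fun_prop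
  have hrep : ∀ y, inner ℝ y (rieszConv α u (x - y)) * Real.exp (-l * ‖y‖ ^ 2) =
      ∫ w, H y w := fun y => by
    have h1 : rieszConv α u (x - y) = ∫ w, u (x - w) • rieszKer α (w - y) := by
      rw [rieszConv, ← integral_sub_right_eq_self _ y]
      simp
    have h2 : Integrable fun w => u (x - w) • rieszKer α (w - y) := by
      have := (integrable_smul_rieszKer hn hα0 hα1 (hui.comp_sub_left (x - y))
        (fun z => hS _)).comp_sub_right y
      simpa using this
    rw [h1, ← integral_inner h2, ← integral_mul_const]
    congr 1; ext w
    simp only [hH, inner_smul_right]; ring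
  have hHb : ∀ y w, ‖H y w‖ ≤ ‖y‖ * Real.exp (-l * ‖y‖ ^ 2) *
      ‖‖w - y‖ ^ (α - n) * u (x - w)‖ := fun y w => by
    simp only [hH]
    rw [norm_mul, norm_mul, Real.norm_of_nonneg (Real.exp_nonneg _), norm_mul,
      Real.norm_of_nonneg (by positivity : 0 ≤ ‖w - y‖ ^ (α - n)), ← norm_rieszKer hn hα1]
    calc _ ≤ ‖u (x - w)‖ * (‖y‖ * ‖rieszKer α (w - y)‖ * Real.exp (-l * ‖y‖ ^ 2)) := by
          gcongr; exact norm_inner_le_norm _ _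
      _ = _ := by ring
  have hKu : ∀ y, Integrable (fun w => ‖w - y‖ ^ (α - n) * u (x - w)) ∧
      ∫ w, ‖‖w - y‖ ^ (α - n) * u (x - w)‖ ≤
        S * (sphereArea n * (1 / α)) + ∫ z, ‖u z‖ := fun y => by
    have h := integrable_rpow_mul_of_bounded hn hα0 hα1 (hui.comp_sub_left (x - y))
      (fun z => hS _)
    refine ⟨by simpa using h.1.comp_sub_right y, ?_⟩
    rw [integral_sub_left_eq_self (fun z => ‖u z‖) volume (x - y)] at h
    refine le_trans (le_of_eq ?_) h.2
    rw [← integral_sub_right_eq_self (fun z => ‖‖z‖ ^ (α - n) * u (x - y - z)‖) y]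
    simp
  have hHprod : Integrable (Function.uncurry H) (volume.prod volume) := by
    rw [integrable_prod_iff hHm.aestronglyMeasurable]
    refine ⟨Eventually.of_forall fun y => ?_, ?_⟩
    · refine ((hKu y).1.norm.const_mul (‖y‖ * Real.exp (-l * ‖y‖ ^ 2))).mono' ?_
        (Eventually.of_forall fun w => hHb y w)
      exact (hHm.comp measurable_prodMk_left).aestronglyMeasurable
    · have h0 : Integrable fun y : Euc n => ‖y‖ * Real.exp (-l * ‖y‖ ^ 2) := by
        simpa using integrable_norm_pow_mul_gauss hn 1 hl
      refine (h0.mul_const (S * (sphereArea n * (1 / α)) + ∫ z, ‖u z‖)).mono'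
        hHm.norm.stronglyMeasurable.integral_prod_right'.aestronglyMeasurable
        (Eventually.of_forall fun y => ?_)
      rw [Real.norm_of_nonneg (integral_nonneg fun _ => norm_nonneg _)]
      calc ∫ w, ‖Function.uncurry H (y, w)‖
          ≤ ∫ w, ‖y‖ * Real.exp (-l * ‖y‖ ^ 2) * ‖‖w - y‖ ^ (α - n) * u (x - w)‖ :=
            integral_mono_of_nonneg (Eventually.of_forall fun _ => norm_nonneg _)
              ((hKu y).1.norm.const_mul _) (Eventually.of_forall fun w => hHb y w)
        _ ≤ _ := by
            rw [integral_const_mul]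
            gcongr
            exact (hKu y).2
  set ρ : Measure ℝ := volume.restrict (Set.Ioi 0) with hρ
  set g : ℝ → Euc n → ℝ := fun κ w => Real.exp (-κ * ‖w‖ ^ 2) * (κ * ‖w‖ ^ 2 - n / 2) with hg
  set Q : Euc n → ℝ → ℝ := fun w ν =>
    u (x - w) * (ν ^ (B - 1) * (m * (l + ν) ^ (-((n : ℝ) / 2) - 1) * g (l * ν / (l + ν)) w)) with hQ
  have hQm : Measurable (Function.uncurry Q) := by
    simp only [hQ, hg]; unfold Function.uncurry; fun_prop
  -- The Gaussian weight is bounded uniformly in κ and w, so the majorant is a product of |u(x - w)|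
  -- and a Beta-type integrand in ν.
  have hQprod : Integrable (Function.uncurry Q) (volume.prod ρ) := by
    have h1 := integrableOn_rpow_mul_add_rpow (a := B) (b := (n : ℝ) / 2 + 1) hB0
      (by rw [hB]; linarith) hl
    refine ((hui.comp_sub_left x).norm.mul_prod
      (h1.norm.const_mul (m * (1 + (n : ℝ) / 2)))).mono' hQm.aestronglyMeasurable ?_
    have hpos : ∀ᵐ z ∂((volume : Measure (Euc n)).prod ρ), z.2 ∈ Set.Ioi (0 : ℝ) :=
      Measure.quasiMeasurePreserving_snd.ae (ae_restrict_mem measurableSet_Ioi)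
    filter_upwards [hpos] with z hz
    have hz0 : 0 < z.2 := hz
    have hm0 : 0 ≤ m := gaussMoment_nonneg 0
    simp only [Function.uncurry, hQ]
    rw [norm_mul, norm_mul, norm_mul, norm_mul, Real.norm_of_nonneg hm0,
      show -((n : ℝ) / 2) - 1 = -((n : ℝ) / 2 + 1) by ring]
    have : ‖g (l * z.2 / (l + z.2)) z.1‖ ≤ 1 + (n : ℝ) / 2 :=
      abs_gauss_mul_le (by positivity) z.1
    generalize g (l * z.2 / (l + z.2)) z.1 = G at this ⊢
    calc _ ≤ ‖u (x - z.1)‖ * (‖z.2 ^ (B - 1)‖ *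
            (m * ‖(l + z.2) ^ (-((n : ℝ) / 2 + 1))‖ * (1 + (n : ℝ) / 2))) := by gcongr
      _ = _ := by rw [norm_mul (z.2 ^ (B - 1))]; ring
  calc ∫ y, inner ℝ y (rieszConv α u (x + y)) * Real.exp (-l * ‖y‖ ^ 2)
      = -∫ y, inner ℝ y (rieszConv α u (x - y)) * Real.exp (-l * ‖y‖ ^ 2) := by
        rw [← integral_neg_eq_self, ← integral_neg]
        congr 1; ext y
        simp [sub_eq_add_neg]
    _ = -∫ y, ∫ w, H y w := by simp only [hrep]
    _ = -∫ w, ∫ y, H y w := by rw [integral_integral_swap hHprod]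
    _ = -∫ w, (Real.Gamma B)⁻¹ * ∫ ν, Q w ν ∂ρ := by
        congr 2; ext w
        simp only [hH, hQ]
        rw [integral_const_mul, integral_inner_rieszKer_mul_gauss hn hα0 hα1 hl w,
          integral_const_mul]
        ring
    _ = -((Real.Gamma B)⁻¹ * ∫ ν, (∫ w, Q w ν) ∂ρ) := by
        rw [integral_const_mul, integral_integral_swap hQprod]
    _ = _ := by
        have e : ∀ ν, ∫ w, Q w ν = m * (ν ^ (B - 1) * (l + ν) ^ (-((n : ℝ) / 2) - 1) *
            gaussDefect u x (l * ν / (l + ν))) := fun ν => by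
          rw [gaussDefect, ← integral_const_mul, ← integral_const_mul]
          congr 1; ext w
          simp only [hQ, hg]; ring
        simp only [e]
        rw [integral_const_mul, mul_assoc]

/-- The fractional divergence of `K * u` is a multiple of `u`. -/
theorem exists_pvDiv_rieszConv (hn : 1 ≤ n) (hα0 : 0 < α) (hα1 : α < 1) :
    ∃ c : ℝ, 0 < c ∧ ∀ (u : Euc n → ℝ) (K : ℝ≥0) (M Λ : ℝ), HasCompactSupport u →
      LipschitzWith K u → IsBddLip (rieszConv α u) M Λ →
        ∀ x, pvDiv α (rieszConv α u) x = c * u x := by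
  have hn' : (1 : ℝ) ≤ n := by exact_mod_cast hn
  set A := ((n : ℝ) + α + 1) / 2 with hA
  set B := ((n : ℝ) + 1 - α) / 2 with hB
  set m := gaussMoment n 0
  have hm : 0 < m := gaussMoment_zero_pos hn
  have hA0 : 0 < Real.Gamma A := Real.Gamma_pos_of_pos (by positivity)
  have hB0 : 0 < Real.Gamma B := Real.Gamma_pos_of_pos (by rw [hB]; linarith)
  -- The constant left by the v-integral after the substitution ν = l v; only its finiteness and
  -- positivity are needed.
  set Z : ℝ := ∫ v in Set.Ioi (0 : ℝ), v ^ ((1 - α) / 2 - 1) * (1 + v) ^ (-1 : ℝ) with hZ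
  have hZi : IntegrableOn (fun v : ℝ => v ^ ((1 - α) / 2 - 1) * (1 + v) ^ (-1 : ℝ)) (Set.Ioi 0) :=
    integrableOn_rpow_mul_add_rpow (by linarith) (by linarith) one_pos
  have hZ0 : 0 < Z := by
    rw [hZ, setIntegral_pos_iff_support_of_nonneg_ae _ hZi]
    · have : Set.Ioi (0 : ℝ) ⊆ Function.support
          (fun v : ℝ => v ^ ((1 - α) / 2 - 1) * (1 + v) ^ (-1 : ℝ)) := fun v hv => by
        have hv0 : 0 < v := hv
        exact (by positivity : 0 < v ^ ((1 - α) / 2 - 1) * (1 + v) ^ (-1 : ℝ)).ne'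
      rw [Set.inter_eq_right.2 this]
      simp
    · filter_upwards [ae_restrict_mem measurableSet_Ioi] with v hv
      have hv0 : 0 < v := hv
      simp only [Pi.zero_apply]; positivity
  refine ⟨(Real.Gamma A)⁻¹ * (Real.Gamma B)⁻¹ * m * m * Z, by positivity, ?_⟩
  intro u K M Λ hc hu hφ x
  have hui : Integrable u := hu.continuous.integrable_of_hasCompactSupport hc
  set ρ : Measure ℝ := volume.restrict (Set.Ioi 0) with hρ
  set h : ℝ → ℝ := fun κ => κ ^ ((n : ℝ) / 2 - 1) * gaussDefect u x κ with hh
  have hhi : IntegrableOn h (Set.Ioi 0) := integrableOn_rpow_mul_gaussDefect hn hui hu x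
  have hhm : Measurable h := by
    have := measurable_gaussDefect hu.continuous.measurable x
    fun_prop
  have hJ : ∫ κ, h κ ∂ρ = -(m * u x) := integral_rpow_mul_gaussDefect hn hc hu x
  -- With ν = l v one has κ = (v/(1+v)) l. W collects the factors in v; its last one compensates the
  -- power of κ built into `h`, and the Jacobian of l ↦ κ then turns W into the integrand of Z.
  set W : ℝ → ℝ := fun v =>
    v ^ (B - 1) * (1 + v) ^ (-((n : ℝ) / 2) - 1) * (v / (1 + v)) ^ (1 - (n : ℝ) / 2) with hW
  set H : ℝ → ℝ → ℝ := fun l v => W v * h (v / (1 + v) * l) with hH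
  have hHm : Measurable (Function.uncurry H) := by
    simp only [hH, hW]; unfold Function.uncurry; fun_prop
  have hWc : ∀ v, 0 < v → W v * (v / (1 + v))⁻¹ =
      v ^ ((1 - α) / 2 - 1) * (1 + v) ^ (-1 : ℝ) := fun v hv => by
    have h1 : 0 < 1 + v := by linarith
    have h2 : 0 < v / (1 + v) := by positivity
    simp only [hW]
    rw [← Real.rpow_neg_one (v / (1 + v)), mul_assoc, ← Real.rpow_add h2, Real.div_rpow hv.le h1.le,
      div_eq_mul_inv (v ^ (1 - (n : ℝ) / 2 + -1)), ← Real.rpow_neg h1.le, mul_mul_mul_comm, ← Real.rpow_add hv,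
      ← Real.rpow_add h1, hB]
    congr 2 <;> ring
  have hscale : ∀ v, 0 < v → ∀ k : ℝ → ℝ,
      ∫ l, k (v / (1 + v) * l) ∂ρ = (v / (1 + v))⁻¹ * ∫ κ, k κ ∂ρ := fun v hv k => by
    have := integral_comp_mul_left_Ioi k 0 (b := v / (1 + v)) (by positivity)
    simpa [hρ] using this
  have hHprod : Integrable (Function.uncurry H) (ρ.prod ρ) := by
    rw [integrable_prod_iff' hHm.aestronglyMeasurable]
    constructor
    · filter_upwards [ae_restrict_mem measurableSet_Ioi] with v hv
      have hv0 : 0 < v := hv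
      change Integrable (fun l => W v * h (v / (1 + v) * l)) ρ
      refine Integrable.const_mul ?_ _
      have := (integrableOn_Ioi_comp_mul_left_iff h 0 (a := v / (1 + v)) (by positivity)).2
        (by simpa using hhi)
      exact this
    · refine (hZi.mul_const (∫ κ, ‖h κ‖ ∂ρ)).congr ?_
      filter_upwards [ae_restrict_mem measurableSet_Ioi] with v hv
      have hv0 : 0 < v := hv
      have hW0 : 0 ≤ W v := by simp only [hW]; positivity
      simp only [Function.uncurry_apply_pair, hH, norm_mul]
      rw [integral_const_mul, hscale v hv0 (fun κ => ‖h κ‖), Real.norm_of_nonneg hW0, ← mul_assoc,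
        hWc v hv0]
  have hinner : ∀ l, 0 < l → l ^ (A - 1) *
      ∫ ν in Set.Ioi (0 : ℝ), ν ^ (B - 1) * (l + ν) ^ (-((n : ℝ) / 2) - 1) *
        gaussDefect u x (l * ν / (l + ν)) = ∫ v, H l v ∂ρ := fun l hl => by
    have h1 := integral_comp_mul_left_Ioi (fun ν => ν ^ (B - 1) * (l + ν) ^ (-((n : ℝ) / 2) - 1) *
        gaussDefect u x (l * ν / (l + ν))) 0 hl
    rw [mul_zero, smul_eq_mul, eq_inv_mul_iff_mul_eq₀ hl.ne'] at h1
    rw [← h1, ← integral_const_mul, ← integral_const_mul]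
    refine setIntegral_congr_fun measurableSet_Ioi fun v hv => ?_
    have hv0 : 0 < v := hv
    have hv1 : 0 < 1 + v := by linarith
    have hc0 : 0 < v / (1 + v) := by positivity
    simp only [hH, hW, hh]
    have e1 : l * (l * v) / (l + l * v) = v / (1 + v) * l := by field_simp
    have e2 : l + l * v = l * (1 + v) := by ring
    -- A + B = n + 1, so the powers of l, with the Jacobian l of ν = l v, combine to exactly the
    -- weight needed for the reconstruction of u.
    have e3 : l ^ (A - 1) * (l * (l ^ (B - 1) * l ^ (-((n : ℝ) / 2) - 1))) =
        l ^ ((n : ℝ) / 2 - 1) := by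
      rw [← Real.rpow_add hl, ← Real.rpow_one_add' hl.le, ← Real.rpow_add hl]
      · congr 1; rw [hA, hB]; ring
      · rw [hB]; intro h0; linarith
    have e4 : (v / (1 + v)) ^ (1 - (n : ℝ) / 2) * (v / (1 + v)) ^ ((n : ℝ) / 2 - 1) = 1 := by
      rw [← Real.rpow_add hc0]; simp
    rw [e1, e2, Real.mul_rpow hl.le hv0.le, Real.mul_rpow hl.le hv1.le,
      Real.mul_rpow hc0.le hl.le]
    calc _ = v ^ (B - 1) * (1 + v) ^ (-((n : ℝ) / 2) - 1) *
          (l ^ (A - 1) * (l * (l ^ (B - 1) * l ^ (-((n : ℝ) / 2) - 1)))) *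
            gaussDefect u x (v / (1 + v) * l) := by ring
      _ = v ^ (B - 1) * (1 + v) ^ (-((n : ℝ) / 2) - 1) * ((v / (1 + v)) ^ (1 - (n : ℝ) / 2) *
            (v / (1 + v)) ^ ((n : ℝ) / 2 - 1) * l ^ ((n : ℝ) / 2 - 1)) *
            gaussDefect u x (v / (1 + v) * l) := by rw [e3, e4, one_mul]
      _ = _ := by ring
  have hdouble : ∫ l, ∫ v, H l v ∂ρ ∂ρ = Z * -(m * u x) := by
    rw [integral_integral_swap hHprod, ← hJ, hZ, ← integral_mul_const]
    refine setIntegral_congr_fun measurableSet_Ioi fun v hv => ?_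
    simp only [hH]
    rw [integral_const_mul, hscale v hv h, ← mul_assoc, hWc v hv]
  rw [pvDiv_eq_integral_gauss hn hα0 hα1 hφ x, ← hA]
  have e : ∫ l in Set.Ioi (0 : ℝ), l ^ (A - 1) *
      ∫ y, inner ℝ y (rieszConv α u (x + y)) * Real.exp (-l * ‖y‖ ^ 2) =
      -((Real.Gamma B)⁻¹ * m) * ∫ l, ∫ v, H l v ∂ρ ∂ρ := by
    rw [← integral_const_mul]
    refine setIntegral_congr_fun measurableSet_Ioi fun l hl => ?_
    rw [integral_inner_rieszConv_mul_gauss hn hα0 hα1 hu.continuous hc hl x, ← hinner l hl]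
    ring
  rw [e, hdouble]
  ring

end Inversion

/-! ### The embedding of `BV^α` -/

section Embedding

variable {n : ℕ} {α : ℝ}

theorem locallyIntegrable_rieszKer (hn : 1 ≤ n) (hα0 : 0 < α) (hα1 : α < 1) :
    LocallyIntegrable (rieszKer α : Euc n → Euc n) := by
  intro x
  refine ⟨Metric.ball 0 (‖x‖ + 1), Metric.isOpen_ball.mem_nhds (by simp), ?_⟩
  have h : IntegrableOn (fun z : Euc n => ‖z‖ ^ (α - n)) (Metric.ball 0 (‖x‖ + 1)) :=
    (integrableOn_ball_norm_rpow_iff hn (by positivity)).2 (by simpa using hα0)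
  refine h.mono' measurable_rieszKer.aestronglyMeasurable (Eventually.of_forall fun z => ?_)
  exact (norm_rieszKer hn hα1 z).le

theorem contDiff_rieszConv (hn : 1 ≤ n) (hα0 : 0 < α) (hα1 : α < 1) {u : Euc n → ℝ}
    (hu : ContDiff ℝ ∞ u) (hc : HasCompactSupport u) : ContDiff ℝ ∞ (rieszConv α u) :=
  hc.contDiff_convolution_right (μ := volume) (ContinuousLinearMap.lsmul ℝ ℝ).flip
    (locallyIntegrable_rieszKer hn hα0 hα1) hu

/-- Moves the difference from g to the kernel. K is not integrable at infinity, but its increments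
are. -/
theorem rieszConv_translate_sub (hn : 1 ≤ n) (hα0 : 0 < α) (hα1 : α < 1) {g : Euc n → ℝ}
    (hg : Continuous g) (hc : HasCompactSupport g) (h x : Euc n) :
    rieszConv α (fun x => g (x - h) - g x) x =
      ∫ z, g (x - z) • (rieszKer α (z + -h) - rieszKer α z) := by
  obtain ⟨S, hS⟩ := hc.exists_bound_of_continuous hg
  have hgi : Integrable g := hg.integrable_of_hasCompactSupport hc
  have i1 : Integrable fun z => g (x - z - h) • rieszKer α z := by
    have := integrable_smul_rieszKer hn hα0 hα1 (hgi.comp_sub_left (x - h)) (fun z => hS _)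
    refine this.congr (Eventually.of_forall fun z => ?_)
    simp only
    rw [sub_right_comm]
  have i2 : Integrable fun z => g (x - z) • rieszKer α z :=
    integrable_smul_rieszKer hn hα0 hα1 (hgi.comp_sub_left x) (fun z => hS _)
  have i3 : Integrable fun z => g (x - z) • rieszKer α (z + -h) := by
    refine (i1.comp_add_right (-h)).congr (Eventually.of_forall fun z => ?_)
    simp only
    congr 2; abel
  have e : ∫ z, g (x - z) • rieszKer α (z + -h) = ∫ z, g (x - z - h) • rieszKer α z := by
    rw [← integral_add_right_eq_self (fun z => g (x - z - h) • rieszKer α z) (-h)]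
    congr 1; ext1 z
    congr 2; abel
  simp only [rieszConv, sub_smul, smul_sub]
  rw [integral_sub i1 i2, integral_sub i3 i2, e]

/-- Young's inequality with the kernel increment in L¹: the sup bound uses |g| ≤ 1, the Lipschitz
bound uses that of g. -/
theorem isBddLip_rieszConv_translate_sub (hn : 1 ≤ n) (hα0 : 0 < α) (hα1 : α < 1)
    {g : Euc n → ℝ} {K : ℝ≥0} (hg : LipschitzWith K g) (hc : HasCompactSupport g)
    (hg1 : ∀ x, |g x| ≤ 1) {h : Euc n} {M : ℝ}
    (hi : Integrable fun z : Euc n => rieszKer α (z + -h) - rieszKer α z)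
    (hM : ∫ z : Euc n, ‖rieszKer α (z + -h) - rieszKer α z‖ ≤ M) :
    IsBddLip (rieszConv α fun x => g (x - h) - g x) M (K * M) := by
  have hM0 : 0 ≤ M := (integral_nonneg fun _ => norm_nonneg _).trans hM
  have hgc := hg.continuous
  have hdom : ∀ x, Integrable fun z => g (x - z) • (rieszKer α (z + -h) - rieszKer α z) :=
    fun x => hi.bdd_smul (φ := fun z => g (x - z)) 1 (Continuous.aestronglyMeasurable (by fun_prop))
      (Eventually.of_forall fun z => hg1 _)
  refine ⟨fun x => ?_, by positivity, fun x y => ?_⟩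
  · rw [rieszConv_translate_sub hn hα0 hα1 hgc hc]
    refine (norm_integral_le_of_norm_le hi.norm (Eventually.of_forall fun z => ?_)).trans hM
    rw [norm_smul]
    exact mul_le_of_le_one_left (norm_nonneg _) (hg1 _)
  · rw [rieszConv_translate_sub hn hα0 hα1 hgc hc, rieszConv_translate_sub hn hα0 hα1 hgc hc,
      ← integral_sub (hdom x) (hdom y)]
    have hb : ∀ z, ‖g (x - z) • (rieszKer α (z + -h) - rieszKer α z) -
        g (y - z) • (rieszKer α (z + -h) - rieszKer α z)‖ ≤
        K * ‖x - y‖ * ‖rieszKer α (z + -h) - rieszKer α z‖ := fun z => by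
      rw [← sub_smul, norm_smul]
      gcongr
      have := hg.dist_le_mul (x - z) (y - z)
      rwa [dist_eq_norm, dist_eq_norm, sub_sub_sub_cancel_right] at this
    refine (norm_integral_le_of_norm_le (hi.norm.const_mul _) (Eventually.of_forall hb)).trans ?_
    rw [integral_const_mul]
    calc _ ≤ K * ‖x - y‖ * M := by gcongr
      _ = _ := by ring

/-- Smooth cut-offs exhausting `ℝⁿ`. -/
theorem exists_cutoff_sequence (n : ℕ) : ∃ (χ : ℕ → Euc n → ℝ) (K : ℝ≥0),
    (∀ k, ContDiff ℝ ∞ (χ k)) ∧ (∀ k, HasCompactSupport (χ k)) ∧ (∀ k x, 0 ≤ χ k x) ∧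
    (∀ k x, χ k x ≤ 1) ∧ (∀ k x y, |χ k x - χ k y| ≤ K * ‖x - y‖) ∧
    ∀ x, ∀ᶠ k in atTop, χ k x = 1 := by
  let b : ContDiffBump (0 : Euc n) := ⟨1, 2, one_pos, one_lt_two⟩
  have hb : ContDiff ℝ ∞ b := b.contDiff
  obtain ⟨K, hK⟩ := hb.lipschitzWith_of_hasCompactSupport b.hasCompactSupport (by simp)
  have hpos : ∀ k : ℕ, (0 : ℝ) < (k : ℝ) + 1 := fun k => by positivity
  refine ⟨fun k x => b (((k : ℝ) + 1)⁻¹ • x), K, fun k => ?_, fun k => ?_, fun k x => b.nonneg,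
    fun k x => b.le_one, fun k x y => ?_, fun x => ?_⟩
  · exact hb.comp (contDiff_const_smul _)
  · exact b.hasCompactSupport.comp_smul (inv_ne_zero (hpos k).ne')
  · have h := hK.dist_le_mul (((k : ℝ) + 1)⁻¹ • x) (((k : ℝ) + 1)⁻¹ • y)
    rw [Real.dist_eq, dist_eq_norm, ← smul_sub, norm_smul, norm_inv,
      Real.norm_of_nonneg (hpos k).le] at h
    refine h.trans ?_
    gcongr
    exact mul_le_of_le_one_left (norm_nonneg _) (inv_le_one_of_one_le₀ (by simp))
  · obtain ⟨N, hN⟩ := exists_nat_ge ‖x‖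
    filter_upwards [eventually_ge_atTop N] with k hk
    refine b.one_of_mem_closedBall (mem_closedBall_zero_iff.2 ?_)
    have hk' : (N : ℝ) ≤ k := by exact_mod_cast hk
    rw [norm_smul, norm_inv, Real.norm_of_nonneg (hpos k).le, inv_mul_le_iff₀ (hpos k)]
    change ‖x‖ ≤ ((k : ℝ) + 1) * 1
    linarith

/-- Common M and Λ give one majorant for all k, so dominated convergence applies in y and then in x.
-/
theorem tendsto_integral_mul_pvDiv (hn : 1 ≤ n) (hα0 : 0 < α) (hα1 : α < 1)
    {φ : ℕ → Euc n → Euc n} {ψ : Euc n → Euc n} {M Λ : ℝ} (hφ : ∀ k, IsBddLip (φ k) M Λ)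
    (hψ : ∀ x, Tendsto (fun k => φ k x) atTop (𝓝 (ψ x))) {f : Euc n → ℝ} (hf : Integrable f) :
    Tendsto (fun k => ∫ x, f x * pvDiv α (φ k) x) atTop (𝓝 (∫ x, f x * pvDiv α ψ x)) := by
  have hpt : ∀ x, Tendsto (fun k => pvDiv α (φ k) x) atTop (𝓝 (pvDiv α ψ x)) := fun x => by
    refine tendsto_integral_of_dominated_convergence (divMajorant n α M Λ)
      (fun k => (integrable_divKer_sub hn hα0 hα1 (hφ k) x).aestronglyMeasurable)
      (integrable_divMajorant hn hα0 hα1 M Λ)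
      (fun k => Eventually.of_forall (norm_divKer_sub_le (hφ k) x))
      (Eventually.of_forall fun y => ?_)
    unfold divKer
    exact (tendsto_const_nhds.inner ((hψ (x + y)).sub (hψ x))).div_const _
  refine tendsto_integral_of_dominated_convergence
    (fun x => ‖f x‖ * ∫ y, divMajorant n α M Λ y) (fun k => ?_) (hf.norm.mul_const _)
    (fun k => Eventually.of_forall fun x => ?_) (Eventually.of_forall fun x => (hpt x).const_mul _)
  · exact hf.aestronglyMeasurable.mul (continuous_pvDiv hn hα0 hα1 (hφ k)).aestronglyMeasurable
  · rw [norm_mul]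
    gcongr
    exact norm_pvDiv_le hn hα0 hα1 (hφ k) x

/-- The duality bound extends to smooth fields without compact support. -/
theorem integral_mul_pvDiv_le (hn : 1 ≤ n) (hα0 : 0 < α) (hα1 : α < 1) {φ : Euc n → Euc n}
    {M Λ : ℝ} (hM : 0 < M) (hφ : IsBddLip φ M Λ) (hs : ContDiff ℝ ∞ φ) {f : Euc n → ℝ}
    (hf : Integrable f) (hV : fracVariation α f < ⊤) :
    muConst n α * ∫ x, f x * pvDiv α φ x ≤ M * (fracVariation α f).toReal := by
  obtain ⟨χ, K, hχs, hχc, hχ0, hχ1, hχl, hχt⟩ := exists_cutoff_sequence n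
  -- The constants do not depend on k, because all the cut-offs share the Lipschitz constant K.
  have hψ : ∀ k, IsBddLip (fun x => χ k x • φ x) M (K * M + Λ) := fun k => by
    refine ⟨fun x => ?_, by have := hφ.lip_nonneg; positivity, fun x y => ?_⟩
    · rw [norm_smul, Real.norm_of_nonneg (hχ0 k x)]
      exact (mul_le_of_le_one_left (norm_nonneg _) (hχ1 k x)).trans (hφ.norm_le x)
    · have e : χ k x • φ x - χ k y • φ y = (χ k x - χ k y) • φ x + χ k y • (φ x - φ y) := by
        module
      rw [e]
      refine (norm_add_le _ _).trans ?_
      rw [norm_smul, norm_smul, Real.norm_of_nonneg (hχ0 k y), Real.norm_eq_abs]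
      calc _ ≤ K * ‖x - y‖ * M + 1 * (Λ * ‖x - y‖) := by
            gcongr
            · exact hχl k x y
            · exact hφ.norm_le x
            · exact hχ1 k y
            · exact hφ.norm_sub_le x y
        _ = _ := by ring
  have hlim := (tendsto_integral_mul_pvDiv hn hα0 hα1 hψ (ψ := φ) (fun x => by
    refine tendsto_const_nhds.congr' ?_
    filter_upwards [hχt x] with k hk
    rw [hk, one_smul]) hf).const_mul (muConst n α)
  refine le_of_tendsto hlim (Eventually.of_forall fun k => ?_)
  -- Dividing by M makes the cut-off field admissible in the supremum defining the variation.
  set θ : Euc n → Euc n := fun x => M⁻¹ • (χ k x • φ x) with hθ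
  have hθt : IsTestField θ := by
    refine ⟨((hχs k).smul hs).const_smul _, ?_, fun x => ?_⟩
    · exact ((hχc k).smul_right (f' := φ)).smul_left (f := fun _ => M⁻¹)
    · rw [hθ, norm_smul, norm_inv, Real.norm_of_nonneg hM.le, inv_mul_le_iff₀ hM, mul_one]
      exact (hψ k).norm_le x
  obtain ⟨Λ', hΛ'⟩ := hθt.exists_isBddLip
  have hpv : ∀ x, pvDiv α θ x = M⁻¹ * pvDiv α (fun x => χ k x • φ x) x := fun x => by
    rw [pvDiv, pvDiv, ← integral_const_mul]
    congr 1; ext y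
    rw [← divKer_smul, smul_sub]
  have h1 : ENNReal.ofReal (∫ x, f x * fracDiv α θ x) ≤ fracVariation α f :=
    le_iSup₂_of_le θ hθt le_rfl
  have h2 := (ENNReal.ofReal_le_iff_le_toReal hV.ne).1 h1
  simp only [fracDiv_eq hn hα0 hα1 hΛ', hpv] at h2
  have e : (fun x => f x * (muConst n α * (M⁻¹ * pvDiv α (fun x => χ k x • φ x) x))) =
      fun x => M⁻¹ * (muConst n α * (f x * pvDiv α (fun x => χ k x • φ x) x)) := by
    ext x; ring
  rw [e, integral_const_mul, integral_const_mul, inv_mul_le_iff₀ hM] at h2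
  exact h2

/-- The `L¹` norm is computed by smooth compactly supported test functions. -/
theorem integral_norm_le_of_forall_test {F : Euc n → ℝ} (hF : Integrable F) {M : ℝ}
    (h : ∀ g : Euc n → ℝ, ContDiff ℝ ∞ g → HasCompactSupport g → (∀ x, |g x| ≤ 1) →
      ∫ x, F x * g x ≤ M) : ∫ x, ‖F x‖ ≤ M := by
  refine le_of_forall_pos_le_add fun ε hε => ?_
  obtain ⟨G, hGc, hGs, hG⟩ := (memLp_one_iff_integrable.2 hF).exist_eLpNorm_sub_le
    ENNReal.one_ne_top le_rfl (half_pos hε)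
  have hGi : Integrable G := hGs.continuous.integrable_of_hasCompactSupport hGc
  have hFG : ∫ x, ‖F x - G x‖ ≤ ε / 2 := by
    have e := eLpNorm_one_eq_ofReal (hF.sub hGi)
    rw [e] at hG
    exact (ENNReal.ofReal_le_ofReal_iff (half_pos hε).le).1 hG
  set d : ℕ → ℝ := fun k => 1 / ((k : ℝ) + 1)
  have hd : ∀ k, 0 < d k := fun k => by positivity
  -- A smooth substitute for the sign of G: bounded by 1, vanishing where G does, with G g → |G| as
  -- d → 0.
  set g : ℕ → Euc n → ℝ := fun k x => G x / √(G x ^ 2 + d k ^ 2) with hg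
  have hpos : ∀ k x, 0 < G x ^ 2 + d k ^ 2 := fun k x => by have := hd k; positivity
  have hg1 : ∀ k x, |g k x| ≤ 1 := fun k x => by
    simp only [hg]
    rw [abs_div, abs_of_nonneg (Real.sqrt_nonneg _), div_le_one (Real.sqrt_pos.2 (hpos k x))]
    exact Real.abs_le_sqrt (by linarith [sq_nonneg (d k)])
  have hgs : ∀ k, ContDiff ℝ ∞ (g k) := fun k =>
    hGs.div (((hGs.pow 2).add contDiff_const).sqrt fun x => (hpos k x).ne')
      fun x => (Real.sqrt_pos.2 (hpos k x)).ne'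
  have hgc : ∀ k, HasCompactSupport (g k) := fun k =>
    hGc.mono fun x hx hG0 => hx (by simp [hg, hG0])
  have hbound : ∀ k, ∫ x, G x * g k x ≤ M + ε / 2 := fun k => by
    have hgm : AEStronglyMeasurable (g k) := (hgs k).continuous.aestronglyMeasurable
    have hb : ∀ᵐ x, ‖g k x‖ ≤ 1 := Eventually.of_forall (hg1 k)
    have i1 : Integrable fun x => F x * g k x := hF.mul_bdd hgm hb
    have i2 : Integrable fun x => (G x - F x) * g k x := (hGi.sub hF).mul_bdd hgm hb
    have e : ∫ x, G x * g k x = (∫ x, F x * g k x) + ∫ x, (G x - F x) * g k x := by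
      rw [← integral_add i1 i2]
      congr 1; ext x; ring
    have h3 : ∫ x, (G x - F x) * g k x ≤ ∫ x, ‖F x - G x‖ := by
      refine integral_mono i2 (hF.sub hGi).norm fun x => ?_
      simp only
      rw [norm_sub_rev]
      refine (le_abs_self _).trans ?_
      rw [abs_mul]
      exact mul_le_of_le_one_right (abs_nonneg _) (hg1 k x)
    rw [e]
    linarith [h (g k) (hgs k) (hgc k) (hg1 k)]
  have hlim : Tendsto (fun k => ∫ x, G x * g k x) atTop (𝓝 (∫ x, ‖G x‖)) := by
    refine tendsto_integral_of_dominated_convergence (fun x => ‖G x‖)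
      (fun k => (hGs.continuous.mul (hgs k).continuous).aestronglyMeasurable) hGi.norm
      (fun k => Eventually.of_forall fun x => ?_) (Eventually.of_forall fun x => ?_)
    · rw [norm_mul]
      exact mul_le_of_le_one_right (norm_nonneg _) (hg1 k x)
    · rcases eq_or_ne (G x) 0 with h0 | h0
      · simp [h0]
      have hdt : Tendsto d atTop (𝓝 0) := tendsto_one_div_add_atTop_nhds_zero_nat
      have h1 : Tendsto (fun k => √(G x ^ 2 + d k ^ 2)) atTop (𝓝 |G x|) := by
        have := ((hdt.pow 2).const_add (G x ^ 2)).sqrt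
        simpa [Real.sqrt_sq_eq_abs] using this
      have h2 := ((tendsto_const_nhds (x := G x)).div h1 (abs_ne_zero.2 h0)).const_mul (G x)
      have e : G x * (G x / |G x|) = ‖G x‖ := by
        rw [Real.norm_eq_abs, ← mul_div_assoc, ← abs_mul_abs_self, mul_div_assoc,
          div_self (abs_ne_zero.2 h0), mul_one]
      rwa [e] at h2
  have hG2 : ∫ x, ‖G x‖ ≤ M + ε / 2 := le_of_tendsto hlim (Eventually.of_forall hbound)
  calc ∫ x, ‖F x‖ ≤ ∫ x, (‖F x - G x‖ + ‖G x‖) := by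
        refine integral_mono hF.norm ((hF.sub hGi).norm.add hGi.norm) fun x => ?_
        simpa using norm_add_le (F x - G x) (G x)
    _ = (∫ x, ‖F x - G x‖) + ∫ x, ‖G x‖ := integral_add (hF.sub hGi).norm hGi.norm
    _ ≤ _ := by linarith

/-- The duality argument: the increment of f is tested against g, the translation passes to g, and u
= g(· - h) - g is recognised as a multiple of the divergence of a field of size D |h|^α. -/
theorem exists_besovSeminorm_le (hn : 1 ≤ n) (hα0 : 0 < α) (hα1 : α < 1) :
    ∃ C : ℝ≥0, ∀ f ∈ BVSpace n α, besovSeminorm α f ≤ C * fracVariation α f := by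
  obtain ⟨D, hD, hDK⟩ := exists_integral_rieszKer_translate_le hn hα0 hα1
  obtain ⟨c, hc, hinv⟩ := exists_pvDiv_rieszConv hn hα0 hα1
  have hμ : 0 < muConst n α := muConst_pos hα0 hα1
  -- D comes from the kernel increments, c from the inversion formula, and the remaining factor
  -- normalises div^α.
  refine ⟨(D / (muConst n α * c)).toNNReal, fun f hf => besovSeminorm_le fun h => ?_⟩
  obtain ⟨hfm, hV⟩ := hf
  have hfi : Integrable f := memLp_one_iff_integrable.1 hfm
  rcases eq_or_ne h 0 with rfl | hh
  · simp
  have hFi : Integrable fun x => f (x + h) - f x := (hfi.comp_add_right h).sub hfi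
  obtain ⟨hKi, hKb⟩ := hDK (-h)
  rw [norm_neg] at hKb
  set V := (fracVariation α f).toReal with hVd
  have hM : 0 < D * ‖h‖ ^ α := by have := norm_pos_iff.2 hh; positivity
  have hmain : ∫ x, ‖f (x + h) - f x‖ ≤ D / (muConst n α * c) * V * ‖h‖ ^ α := by
    refine integral_norm_le_of_forall_test hFi fun g hgs hgc hg1 => ?_
    obtain ⟨K, hK⟩ := hgs.lipschitzWith_of_hasCompactSupport hgc (by simp)
    have hgt : HasCompactSupport fun x => g (x - h) := hgc.comp_homeomorph (Homeomorph.subRight h)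
    have hgts : ContDiff ℝ ∞ fun x => g (x - h) := hgs.comp (contDiff_id.sub contDiff_const)
    set u : Euc n → ℝ := fun x => g (x - h) - g x with hu
    have huc : HasCompactSupport u := hgt.sub hgc
    have hus : ContDiff ℝ ∞ u := hgts.sub hgs
    obtain ⟨K', hK'⟩ := hus.lipschitzWith_of_hasCompactSupport huc (by simp)
    have hbl : IsBddLip (rieszConv α u) (D * ‖h‖ ^ α) (K * (D * ‖h‖ ^ α)) :=
      isBddLip_rieszConv_translate_sub hn hα0 hα1 hK hgc hg1 hKi hKb
    have hle := integral_mul_pvDiv_le hn hα0 hα1 hM hbl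
      (contDiff_rieszConv hn hα0 hα1 hus huc) hfi hV
    simp only [hinv u K' _ _ huc hK' hbl] at hle
    have hb1 : ∀ᵐ x : Euc n, ‖g (x - h)‖ ≤ 1 := Eventually.of_forall fun x => hg1 _
    have hb2 : ∀ᵐ x : Euc n, ‖g x‖ ≤ 1 := Eventually.of_forall fun x => hg1 _
    have i1 : Integrable fun x => f x * g (x - h) :=
      hfi.mul_bdd hgts.continuous.aestronglyMeasurable hb1
    have i2 : Integrable fun x => f x * g x := hfi.mul_bdd hgs.continuous.aestronglyMeasurable hb2
    have i3 : Integrable fun x => f (x + h) * g x :=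
      (hfi.comp_add_right h).mul_bdd hgs.continuous.aestronglyMeasurable hb2
    have e : ∫ x, f x * (c * u x) = c * ∫ x, (f (x + h) - f x) * g x := by
      have e1 : ∫ x, f (x + h) * g x = ∫ x, f x * g (x - h) := by
        rw [← integral_add_right_eq_self (fun x => f x * g (x - h)) h]
        simp
      rw [← integral_const_mul]
      calc ∫ x, f x * (c * u x) = ∫ x, c * (f x * g (x - h) - f x * g x) := by
            congr 1; ext x; simp only [hu]; ring
        _ = ∫ x, c * (f (x + h) * g x - f x * g x) := by
            rw [integral_const_mul, integral_const_mul, integral_sub i1 i2, integral_sub i3 i2, e1]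
        _ = _ := by congr 1; ext x; ring
    rw [e, ← mul_assoc] at hle
    rw [show D / (muConst n α * c) * V * ‖h‖ ^ α =
      D * ‖h‖ ^ α * V / (muConst n α * c) by ring, le_div_iff₀ (by positivity), mul_comm]
    exact hle
  have hC : 0 ≤ D / (muConst n α * c) := by positivity
  rw [eLpNorm_one_eq_ofReal hFi]
  refine (ENNReal.ofReal_le_ofReal hmain).trans_eq ?_
  rw [ENNReal.ofReal_mul (by positivity), ENNReal.ofReal_mul hC, hVd,
    ENNReal.ofReal_toReal hV.ne]
  rfl

theorem BVSpace_subset_BesovSpace (hn : 1 ≤ n) (hα0 : 0 < α) (hα1 : α < 1) :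
    BVSpace n α ⊆ BesovSpace n α := by
  obtain ⟨C, hC⟩ := exists_besovSeminorm_le (n := n) hn hα0 hα1
  exact fun f hf => ⟨hf.1, (hC f hf).trans_lt (ENNReal.mul_lt_top ENNReal.coe_lt_top hf.2)⟩

theorem exists_besovNorm_le (hn : 1 ≤ n) (hα0 : 0 < α) (hα1 : α < 1) :
    ∃ C : ℝ≥0, ∀ f ∈ BVSpace n α, besovNorm α f ≤ C * bvNorm α f := by
  obtain ⟨C, hC⟩ := exists_besovSeminorm_le (n := n) hn hα0 hα1
  refine ⟨1 + C, fun f hf => ?_⟩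
  rw [besovNorm, bvNorm, mul_add, ENNReal.coe_add, ENNReal.coe_one]
  refine add_le_add ?_ ((hC f hf).trans ?_)
  · exact le_mul_of_one_le_left' le_self_add
  · gcongr
    exact le_add_self

end Embedding

end FracBV

theorem mainTheorem9 (n : ℕ) (hn : 2 ≤ n) (α : ℝ) (hα : α ∈ Set.Ioo (0 : ℝ) 1) :
    (∃ C : ℝ≥0, ∀ f ∈ FracBV.BVSpace n α, FracBV.besovNorm α f ≤ C * FracBV.bvNorm α f) ∧
    FracBV.BVSpace n α ⊂ FracBV.BesovSpace n α ∧
    ∀ η : ℝ → ℝ, FracBV.IsCutoffProfile η →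
      FracBV.witness n α η ∈ FracBV.BesovSpace n α ∧
      ¬ MemLp (FracBV.witness n α η) (ENNReal.ofReal ((n : ℝ) / ((n : ℝ) - α))) volume ∧
      FracBV.witness n α η ∉ FracBV.BVSpace n α := by
  obtain ⟨hα0, hα1⟩ := hα
  have hn1 : 1 ≤ n := by omega
  refine ⟨FracBV.exists_besovNorm_le hn1 hα0 hα1, ?_, fun η hη => ?_⟩
  · refine (Set.ssubset_iff_of_subset (FracBV.BVSpace_subset_BesovSpace hn1 hα0 hα1)).2 ?_
    -- Strictness is witnessed with the piecewise linear profile, independently of any admissible η.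
    exact ⟨_, FracBV.witness_mem_besovSpace hn1 hα0 hα1 FracBV.isRadialCutoff_piecewiseLinear,
      FracBV.witness_notMem_BVSpace hn hα0 hα1 FracBV.isRadialCutoff_piecewiseLinear⟩
  · have h := hη.isRadialCutoff
    exact ⟨FracBV.witness_mem_besovSpace hn1 hα0 hα1 h, FracBV.witness_not_memLp hn1 hα0 hα1 h,
      FracBV.witness_notMem_BVSpace hn hα0 hα1 h⟩

end
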